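/- Let $\psi\in\mathbb{C}\setminus\{0\}$ and let $u:\mathbb{R}\to\mathbb{R}$ be a non-constant $C^2$ solution of the Gauss equation $\tfrac14u''+e^{u}-|\psi|^2e^{-2u}=0$ with $u'(0)=0$ (so $2e^{u}|dz|^2$, $u=u(y)$, $z=x+iy$, and $\psi\,dz^3$ are the metric and the cubic differential of a non-flat translationally equivariant minimal Lagrangian surface in $\mathbb{C}P^2$). Let $\beta$ be the constant value of $2e^{u}+|\psi|^2e^{-2u}+\tfrac14(u')^2$ and assume that $e^{u(0)}$ is the largest root of $8w^3-4\beta w^2+4|\psi|^2=0$. Put $g_2=\tfrac43\beta^2$, $g_3=16|\psi|^2-\tfrac8{27}\beta^3$, let $\wp,\zeta$ be the Weierstrass functions with invariants $g_2,g_3$, whose period lattice $\Lambda$ is generated by $2\omega>0$ and $2\omega'\in i\mathbb{R}_{>0}$, and let $\eta=\zeta(\omega)$. For $|\lambda|=1$ let $i d_1,i d_2,i d_3$ ($d_j\in\mathbb{R}$) be the eigenvalues of $$D(\lambda)=\begin{pmatrix}0&-i\lambda\bar\psi e^{-u(0)}&i\lambda^{-1}e^{u(0)/2}\\-i\lambda^{-1}\psi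 e^{-u(0)}&0&i\lambda e^{u(0)/2}\\ i\lambda e^{u(0)/2}&i\lambda^{-1}e^{u(0)/2}&0\end{pmatrix}$$ and set $$\beta_1(y)=\int_0^y\frac{2i\lambda^3\bar\psi-iu'e^u}{\lambda^3\bar\psi-\lambda^{-3}\psi-e^uu'}\,ds,\quad \beta_2(y)=\int_0^y\frac{2e^u}{\lambda^3\bar\psi-\lambda^{-3}\psi-e^uu'}\,ds,\quad G_j(y)=\int_0^y\frac{d_j\,\mathrm{Im}(\lambda^{-3}\psi)}{d_je^u-\mathrm{Re}(\lambda^{-3}\psi)}\,ds.$$ (a) Suppose $\mathrm{Im}(\lambda^{-3}\psi)\ne0$ and $\mathrm{Re}(\lambda^{-3}\psi)\neq0$. Then the cubic $4x^3-g_2x-\tilde g_3$, $\tilde g_3=g_3-16[\mathrm{Im}(\lambda^{-3}\psi)]^2$, has three distinct real roots $\tilde e_1>\tilde e_2>\tilde e_3$, and the $d_j$ can be numbered such that $\tilde e_j=\tfrac\beta3+d_kd_l$ for $\{j,k,l\}=\{1,2,3\}$. For each $j$ there is $\alpha_j\in\mathbb{C}\setminus\Lambda$ with $|\mathrm{Im}\,\alpha_j|<\mathrm{Im}\,\omega'$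 and $\wp(\alpha_j)=\tilde e_j$. The integrands of $\beta_1,\beta_2,G_j$ are integrable on $[0,2\omega]$, and for every such choice of $\alpha_1,\alpha_2,\alpha_3$ one has $\wp'(\alpha_j)\ne0$ and, with $\tilde H_j^2=(\tilde e_j-\tilde e_k)(\tilde e_j-\tilde e_l)$, $$\beta_1(2\omega)=2\omega i-4\,\mathrm{Im}(\lambda^{-3}\psi)\,\mathrm{Re}(\lambda^{-3}\psi)\sum_{j=1}^3\frac1{\tilde H_j^2}\,\frac{4\omega\zeta(\alpha_j)-4\alpha_j\eta}{\wp'(\alpha_j)},$$ $$\beta_2(2\omega)=2i\,\mathrm{Im}(\lambda^{-3}\psi)\sum_{j=1}^3\frac{\frac\beta3-\tilde e_j}{\tilde H_j^2}\,\frac{4\omega\zeta(\alpha_j)-4\alpha_j\eta}{\wp'(\alpha_j)},$$ $$G_j(2\omega)=-2\,\mathrm{Im}(\lambda^{-3}\psi)\,\frac{4\omega\zeta(\alpha_j)-4\alpha_j\eta}{\wp'(\alpha_j)}\qquad(j=1,2,3).$$ (b) Suppose $\lambda^{-3}\psi$ is real. Then $G_j(2\omega)=0$ for $j=1,2,3$,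 and $\beta_1(2\omega)=2\omega i$, $\beta_2(2\omega)=0$, where the integrals for $\beta_1(2\omega)$ and $\beta_2(2\omega)$, whose integrands are singular at the zeros of $u'$ in $[0,2\omega]$, are Cauchy principal values: limits as $\varepsilon\to0^+$ of the integrals over the points of $[0,2\omega]$ at distance at least $\varepsilon$ from these zeros. -/

import Mathlib

open scoped Topology

/-- The Weierstrass zeta function
`ζ(z) = 1/z + ∑_{l ≠ 0} (1/(z - l) + 1/l + z/l²)` of the lattice of `L`. The summand at `l = 0`
is `1/z`, because division by zero gives zero. -/
noncomputable def PeriodPair.weierstrassZeta (L : PeriodPair) (z : ℂ) : ℂ :=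
  ∑' l : L.lattice, (1 / (z - l) + 1 / (l : ℂ) + z / (l : ℂ) ^ 2)

/-- The metric data of a translationally equivariant minimal Lagrangian surface in `ℂP²`:
the metric is `2 e^u dz dz̄` with `u = u(y)`, `z = x + i y`, the cubic Hopf differential is `ψ dz³`
with a constant `ψ ≠ 0`, the surface is not flat (`u` is not constant), `β` is the value of the
first integral of the Gauss equation, and the origin is chosen such that `u'(0) = 0` and `e^{u(0)}`
is the largest root of `8 w³ - 4 β w² + 4 |ψ|² = 0`. -/
structure IsEquivariantMetric (u : ℝ → ℝ) (ψ : ℂ) (β : ℝ) : Prop where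
  hopf_ne_zero : ψ ≠ 0
  contDiff : ContDiff ℝ 2 u
  gauss : ∀ y, (1 / 4) * deriv (deriv u) y + Real.exp (u y)
    - ‖ψ‖ ^ 2 * Real.exp (-2 * u y) = 0
  first_integral : ∀ y, 2 * Real.exp (u y) + ‖ψ‖ ^ 2 * Real.exp (-2 * u y)
    + (1 / 4) * (deriv u y) ^ 2 = β
  not_constant : ¬ ∃ c, ∀ y, u y = c
  deriv_zero : deriv u 0 = 0
  largest_root : IsGreatest {w : ℝ | 8 * w ^ 3 - 4 * β * w ^ 2 + 4 * ‖ψ‖ ^ 2 = 0} (Real.exp (u 0))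

/-- The coefficient `λ⁻³ ψ` of the cubic differential in the associated family. -/
noncomputable def hopfCoeff (ψ lam : ℂ) : ℂ := (lam ^ 3)⁻¹ * ψ

/-- The matrix `D(λ)` of the generating potential `D(λ) dz`. -/
noncomputable def potentialMatrix (u : ℝ → ℝ) (ψ lam : ℂ) : Matrix (Fin 3) (Fin 3) ℂ :=
  !![0, -Complex.I * lam * (starRingEnd ℂ) ψ * Real.exp (-u 0),
        Complex.I * lam⁻¹ * Real.exp (u 0 / 2);
     -Complex.I * lam⁻¹ * ψ * Real.exp (-u 0), 0, Complex.I * lam * Real.exp (u 0 / 2);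
     Complex.I * lam * Real.exp (u 0 / 2), Complex.I * lam⁻¹ * Real.exp (u 0 / 2), 0]

/-- The common denominator `λ³ ψ̄ - λ⁻³ ψ - e^u u'` of the derivatives of `β₁` and `β₂`. -/
noncomputable def betaDenom (u : ℝ → ℝ) (ψ lam : ℂ) (s : ℝ) : ℂ :=
  lam ^ 3 * (starRingEnd ℂ) ψ - hopfCoeff ψ lam - (Real.exp (u s) * deriv u s : ℝ)

/-- The derivative of `β₁`. -/
noncomputable def betaOneIntegrand (u : ℝ → ℝ) (ψ lam : ℂ) (s : ℝ) : ℂ :=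
  (2 * Complex.I * lam ^ 3 * (starRingEnd ℂ) ψ
    - Complex.I * (deriv u s * Real.exp (u s) : ℝ)) / betaDenom u ψ lam s

/-- The derivative of `β₂`. -/
noncomputable def betaTwoIntegrand (u : ℝ → ℝ) (ψ lam : ℂ) (s : ℝ) : ℂ :=
  (2 * Real.exp (u s) : ℝ) / betaDenom u ψ lam s

/-- The derivative of `G_j`, as a function of the eigenvalue `i d = i d_j` of `D(λ)`. -/
noncomputable def phaseIntegrand (u : ℝ → ℝ) (ψ lam : ℂ) (d : ℝ) (s : ℝ) : ℝ :=
  d * (hopfCoeff ψ lam).im / (d * Real.exp (u s) - (hopfCoeff ψ lam).re)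

noncomputable def betaOne (u : ℝ → ℝ) (ψ lam : ℂ) (y : ℝ) : ℂ :=
  ∫ s in (0 : ℝ)..y, betaOneIntegrand u ψ lam s

noncomputable def betaTwo (u : ℝ → ℝ) (ψ lam : ℂ) (y : ℝ) : ℂ :=
  ∫ s in (0 : ℝ)..y, betaTwoIntegrand u ψ lam s

noncomputable def phaseG (u : ℝ → ℝ) (ψ lam : ℂ) (d : ℝ) (y : ℝ) : ℝ :=
  ∫ s in (0 : ℝ)..y, phaseIntegrand u ψ lam d s

/-- `f` has the Cauchy principal value `v` on `[a, b]` with respect to the singular set `S`: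
`f` is integrable off every `ε`-neighbourhood of `S`, and the integrals over the complements of
these neighbourhoods tend to `v` as `ε → 0+`. -/
def HasPrincipalValue (f : ℝ → ℂ) (a b : ℝ) (S : Set ℝ) (v : ℂ) : Prop :=
  (∀ ε > 0, MeasureTheory.IntegrableOn f (Set.Icc a b \ Metric.thickening ε S)) ∧
  Filter.Tendsto (fun ε : ℝ => ∫ s in Set.Icc a b \ Metric.thickening ε S, f s) (𝓝[>] 0) (𝓝 v)

/-- `H̃_j² = (ẽ_j - ẽ_k)(ẽ_j - ẽ_l)` for `{j, k, l} = {0, 1, 2}`. -/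
def rootProduct (e : Fin 3 → ℝ) (j : Fin 3) : ℝ := (e j - e (j + 1)) * (e j - e (j + 2))

/-- The quantity `(4 ω ζ(α) - 4 α η) / ℘'(α)` with `η = ζ(ω)`. -/
noncomputable def zetaTerm (L : PeriodPair) (ω : ℝ) (α : ℂ) : ℂ :=
  (4 * ω * L.weierstrassZeta α - 4 * α * L.weierstrassZeta ω) / L.derivWeierstrassP α

/-!
The function `y ↦ β / 3 - 2 e^{u y}` satisfies the differential equation of `℘` with the invariants
`g₂`, `g₃`, and at `y = 0` it takes the value `℘(ω')` with vanishing derivative, so it equals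
`℘(ω' + y)` by uniqueness. Hence `u` is even and `2ω`-periodic, and under the reflection
`y ↦ 2ω - y` only the term `e^u u'` of the common denominator of the integrands of `β₁` and `β₂`
changes sign. Adding an integrand to its reflection leaves a rational function of `℘(ω' + y)` whose
denominator is `∏ j, (℘(ω' + y) - ẽ_j)`; if `λ⁻³ ψ` is real, it leaves a constant. Partial fractions
reduce everything to the integrals of `1 / (℘(ω' + y) - ℘(α))` over a period, which come from
`℘'(α) / (℘(z) - ℘(α)) = ζ(z - α) - ζ(z + α) + 2 ζ(α)` and the quasi-periodicity of `ζ`.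
-/

open Complex Filter MeasureTheory Set
open scoped ComplexConjugate

/-- The Weierstrass zeta function of `L` with the summand of `l₀` removed, the counterpart of
`PeriodPair.weierstrassPExcept`. It is regular at `l₀`. -/
noncomputable def weierstrassZetaExcept (L : PeriodPair) (l₀ z : ℂ) : ℂ :=
  ∑' l : L.lattice, if l = l₀ then 0 else 1 / (z - l) + 1 / (l : ℂ) + z / (l : ℂ) ^ 2

section WeierstrassZeta

lemma norm_zeta_summand_le {r : ℝ} {z l : ℂ} (hz : ‖z‖ < r) (hl : 2 * r ≤ ‖l‖) :
    ‖1 / (z - l) + 1 / l + z / l ^ 2‖ ≤ 2 * r ^ 2 * ‖l‖ ^ (-3 : ℝ) := by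
  have hr : 0 < r := (norm_nonneg z).trans_lt hz
  have hl_pos : 0 < ‖l‖ := by linarith
  have hl_ne : l ≠ 0 := norm_pos_iff.mp hl_pos
  have hdist : ‖l‖ / 2 ≤ ‖z - l‖ := by
    rw [norm_sub_rev]
    exact .trans (by linarith) (norm_sub_norm_le l z)
  have hsub_ne : z - l ≠ 0 := norm_pos_iff.mp (by linarith)
  have hsum : 1 / (z - l) + 1 / l + z / l ^ 2 = z ^ 2 / ((z - l) * l ^ 2) := by
    field_simp
    ring
  calc ‖1 / (z - l) + 1 / l + z / l ^ 2‖
      = ‖z‖ ^ 2 / (‖z - l‖ * ‖l‖ ^ 2) := by rw [hsum, norm_div, norm_mul, norm_pow, norm_pow]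
    _ ≤ r ^ 2 / (‖l‖ / 2 * ‖l‖ ^ 2) := by gcongr
    _ = 2 * r ^ 2 / ‖l‖ ^ 3 := by field
    _ = 2 * r ^ 2 * ‖l‖ ^ (-3 : ℝ) := by norm_cast

lemma summable_zeta_summand (L : PeriodPair) (z : ℂ) :
    Summable fun l : L.lattice ↦ 1 / (z - l) + 1 / (l : ℂ) + z / (l : ℂ) ^ 2 := by
  refine ((L.hasSumLocallyUniformly_aux (u := (2 * · ^ 2 * ‖·‖ ^ (-3 : ℝ)))
    (fun (l : L.lattice) (z : ℂ) ↦ 1 / (z - l) + 1 / (l : ℂ) + z / (l : ℂ) ^ 2)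
    (fun _ _ ↦ (ZLattice.summable_norm_rpow _ _ (by simp; norm_num)).mul_left _)
    fun r _ ↦ eventually_atTop.mpr ⟨2 * r, ?_⟩).hasSum (x := z)).summable
  rintro _ hR w hw l rfl
  exact norm_zeta_summand_le hw hR

lemma hasSum_weierstrassZetaExcept (L : PeriodPair) (l₀ z : ℂ) :
    HasSum (fun l : L.lattice ↦
      if l = l₀ then 0 else 1 / (z - l) + 1 / (l : ℂ) + z / (l : ℂ) ^ 2)
      (weierstrassZetaExcept L l₀ z) := by
  refine Summable.hasSum (.of_norm_bounded (summable_zeta_summand L z).norm fun l ↦ ?_)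
  split_ifs <;> simp

lemma weierstrassZetaExcept_add (L : PeriodPair) (l₀ : L.lattice) (z : ℂ) :
    weierstrassZetaExcept L l₀ z + (1 / (z - l₀) + 1 / (l₀ : ℂ) + z / (l₀ : ℂ) ^ 2) =
      L.weierstrassZeta z := by
  rw [PeriodPair.weierstrassZeta, (summable_zeta_summand L z).tsum_eq_add_tsum_ite l₀, add_comm,
    weierstrassZetaExcept]
  simp only [Subtype.ext_iff]

lemma hasDerivAt_zeta_summand {z l : ℂ} (h : z ≠ l) :
    HasDerivAt (fun z : ℂ ↦ 1 / (z - l) + 1 / l + z / l ^ 2)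
      (-(1 / (z - l) ^ 2 - 1 / l ^ 2)) z := by
  convert! ((((hasDerivAt_id z).sub_const l).inv (sub_ne_zero.mpr h)).add_const (1 / l)).add
    ((hasDerivAt_id z).div_const (l ^ 2)) using 1
  · ext; simp
  · simp only [id_eq]; ring

lemma hasDerivAt_weierstrassZetaExcept (L : PeriodPair) {l₀ z : ℂ}
    (hz : z ∉ (L.lattice : Set ℂ) \ {l₀}) :
    HasDerivAt (weierstrassZetaExcept L l₀) (-L.weierstrassPExcept l₀ z) z := by
  have hderiv : ∀ (l : L.lattice), ∀ w ∈ ((L.lattice : Set ℂ) \ {l₀})ᶜ, HasDerivAt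
      (fun w ↦ if l = l₀ then 0 else 1 / (w - l) + 1 / (l : ℂ) + w / (l : ℂ) ^ 2)
      (-(if l = l₀ then 0 else 1 / (w - l) ^ 2 - 1 / (l : ℂ) ^ 2)) w := by
    intro l w hw
    split_ifs with hl
    · simpa using hasDerivAt_const w (0 : ℂ)
    · exact hasDerivAt_zeta_summand (by rintro rfl; exact hw ⟨l.2, hl⟩)
  have hunif := ((L.hasSumLocallyUniformly_weierstrassPExcept l₀).tendstoLocallyUniformlyOn
    (s := ((L.lattice : Set ℂ) \ {l₀})ᶜ)).neg
  refine hasDerivAt_of_tendstoLocallyUniformlyOn (g' := -L.weierstrassPExcept l₀)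
    L.isOpen_compl_lattice_sdiff hunif (.of_forall fun s w hw ↦ ?_)
    (fun w _ ↦ hasSum_weierstrassZetaExcept L l₀ w) hz
  convert! HasDerivAt.fun_sum fun l (_ : l ∈ s) ↦ hderiv l w hw using 1
  simp

lemma hasDerivAt_weierstrassZeta (L : PeriodPair) {z : ℂ} (hz : z ∉ L.lattice) :
    HasDerivAt L.weierstrassZeta (-L.weierstrassP z) z := by
  have hz₀ : z ≠ (0 : L.lattice) := by rintro rfl; exact hz (zero_mem _)
  convert! (hasDerivAt_weierstrassZetaExcept L (l₀ := (0 : L.lattice)) (fun h ↦ hz h.1)).add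
    (hasDerivAt_zeta_summand hz₀) using 1
  · ext w; exact (weierstrassZetaExcept_add L 0 w).symm
  · rw [← L.weierstrassPExcept_add 0 z, neg_add]

lemma analyticAt_weierstrassZeta (L : PeriodPair) {z : ℂ} (hz : z ∉ L.lattice) :
    AnalyticAt ℂ L.weierstrassZeta z :=
  (show DifferentiableOn ℂ L.weierstrassZeta (L.lattice : Set ℂ)ᶜ from fun _ hw ↦
    (hasDerivAt_weierstrassZeta L hw).differentiableAt.differentiableWithinAt).analyticAt
    (L.isClosed_lattice.isOpen_compl.mem_nhds hz)

lemma analyticAt_weierstrassZeta_sub_inv (L : PeriodPair) {l : ℂ} (hl : l ∈ L.lattice) :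
    AnalyticAt ℂ (fun z ↦ L.weierstrassZeta z - (z - l)⁻¹) l := by
  have hexcept : AnalyticAt ℂ (weierstrassZetaExcept L l) l :=
    (show DifferentiableOn ℂ (weierstrassZetaExcept L l) ((L.lattice : Set ℂ) \ {l})ᶜ from
      fun _ hw ↦ (hasDerivAt_weierstrassZetaExcept L hw).differentiableAt.differentiableWithinAt
      ).analyticAt (L.compl_lattice_sdiff_singleton_mem_nhds l)
  convert! hexcept.add (g := fun z ↦ 1 / l + z / l ^ 2) (by fun_prop) using 1
  ext z
  rw [← weierstrassZetaExcept_add L ⟨l, hl⟩ z]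
  simp only [one_div, Pi.add_apply]
  ring

lemma meromorphic_weierstrassZeta (L : PeriodPair) : Meromorphic L.weierstrassZeta := by
  intro x
  by_cases hx : x ∈ L.lattice
  · convert! (analyticAt_weierstrassZeta_sub_inv L hx).meromorphicAt.add
      (g := fun z ↦ (z - x)⁻¹) (by fun_prop) using 1
    ext z
    simp
  · exact (analyticAt_weierstrassZeta L hx).meromorphicAt

lemma neg_one_le_meromorphicOrderAt_weierstrassZeta (L : PeriodPair) (x : ℂ) :
    -1 ≤ meromorphicOrderAt L.weierstrassZeta x := by
  by_cases hx : x ∈ L.lattice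
  · have hreg := analyticAt_weierstrassZeta_sub_inv L hx
    have hpole : meromorphicOrderAt (fun z ↦ (z - x)⁻¹) x = -1 := by
      exact meromorphicOrderAt_inv.trans (by rw [meromorphicOrderAt_id_sub_const])
    rw [show L.weierstrassZeta =
      (fun z ↦ L.weierstrassZeta z - (z - x)⁻¹) + fun z ↦ (z - x)⁻¹ by ext z; simp]
    refine (le_min ?_ hpole.ge).trans
      (meromorphicOrderAt_add hreg.meromorphicAt (by fun_prop))
    exact le_trans (by decide) hreg.meromorphicOrderAt_nonneg
  · exact le_trans (by decide) (analyticAt_weierstrassZeta L hx).meromorphicOrderAt_nonneg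

lemma weierstrassZeta_neg (L : PeriodPair) (z : ℂ) :
    L.weierstrassZeta (-z) = -L.weierstrassZeta z := by
  simp only [PeriodPair.weierstrassZeta]
  rw [← (Equiv.neg L.lattice).tsum_eq, ← tsum_neg]
  congr with l
  rw [Equiv.neg_apply, NegMemClass.coe_neg, show -z - -(l : ℂ) = -(z - l) by ring]
  simp only [one_div, inv_neg]
  ring

lemma weierstrassZeta_zero (L : PeriodPair) : L.weierstrassZeta 0 = 0 := by
  simpa [self_eq_neg] using weierstrassZeta_neg L 0

lemma eventually_notMem_lattice (L : PeriodPair) (x : ℂ) : ∀ᶠ y in 𝓝[≠] x, y ∉ L.lattice := by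
  filter_upwards [nhdsWithin_le_nhds (L.compl_lattice_sdiff_singleton_mem_nhds x),
    self_mem_nhdsWithin] with y hy hyx h using hy ⟨h, hyx⟩

lemma analyticAt_weierstrassZeta_add_coe_sub (L : PeriodPair) (l : L.lattice) (x : ℂ) :
    AnalyticAt ℂ (fun z ↦ L.weierstrassZeta (z + l) - L.weierstrassZeta z) x := by
  by_cases hx : x ∈ L.lattice
  · have hxl := (analyticAt_weierstrassZeta_sub_inv L (add_mem hx l.2)).comp_of_eq
      (f := fun z : ℂ ↦ z + l) (by fun_prop) rfl
    convert! hxl.sub (analyticAt_weierstrassZeta_sub_inv L hx) using 1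
    ext z
    simp
  · have hxl : x + l ∉ L.lattice := fun h ↦ hx (by simpa using sub_mem h l.2)
    exact ((analyticAt_weierstrassZeta L hxl).comp_of_eq (f := fun z : ℂ ↦ z + l)
      (by fun_prop) rfl).sub (analyticAt_weierstrassZeta L hx)

/- The identity also holds at lattice points: there the sum defining `ζ` drops the polar part
`1 / (z - l)`, so its value is the regular part of `ζ`. -/
lemma weierstrassZeta_add_coe (L : PeriodPair) (z : ℂ) (l : L.lattice) :
    L.weierstrassZeta (z + l) = L.weierstrassZeta z + L.weierstrassZeta l := by
  set D : ℂ → ℂ := fun z ↦ L.weierstrassZeta (z + l) - L.weierstrassZeta z with hD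
  have hanalytic (x : ℂ) : AnalyticAt ℂ D x := analyticAt_weierstrassZeta_add_coe_sub L l x
  have hderiv (x : ℂ) : deriv D x = 0 := by
    refine ((hanalytic x).deriv.continuousAt.eventuallyEq_nhds_iff_eventuallyEq_nhdsNE
      (g := fun _ ↦ 0) continuousAt_const).mp ?_ |>.eq_of_nhds
    filter_upwards [eventually_notMem_lattice L x] with y hy
    have hyl : y + l ∉ L.lattice := fun h ↦ hy (by simpa using sub_mem h l.2)
    have hD' : HasDerivAt D (-L.weierstrassP (y + l) - -L.weierstrassP y) y :=
      ((hasDerivAt_weierstrassZeta L hyl).comp_add_const y l).sub (hasDerivAt_weierstrassZeta L hy)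
    rw [hD'.deriv, L.weierstrassP_add_coe, sub_self]
  have hconst : D z = D 0 :=
    is_const_of_deriv_eq_zero (fun x ↦ (hanalytic x).differentiableAt) hderiv z 0
  simp only [hD, zero_add, weierstrassZeta_zero, sub_zero] at hconst
  rw [← hconst, add_sub_cancel]

lemma weierstrassZeta_ω₁ (L : PeriodPair) :
    L.weierstrassZeta L.ω₁ = 2 * L.weierstrassZeta (L.ω₁ / 2) := by
  have h := weierstrassZeta_add_coe L (-(L.ω₁ / 2)) ⟨L.ω₁, L.ω₁_mem_lattice⟩
  rw [show -(L.ω₁ / 2) + (⟨L.ω₁, L.ω₁_mem_lattice⟩ : L.lattice) = L.ω₁ / 2 by push_cast; ring,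
    weierstrassZeta_neg] at h
  linear_combination -h

end WeierstrassZeta

section WeierstrassP

lemma hasDerivAt_weierstrassP (L : PeriodPair) {z : ℂ} (hz : z ∉ L.lattice) :
    HasDerivAt L.weierstrassP (L.derivWeierstrassP z) z := by
  rw [← L.deriv_weierstrassP]
  exact (L.analyticOnNhd_weierstrassP z hz).differentiableAt.hasDerivAt

lemma derivWeierstrassP_eq_zero_of_two_mul_mem (L : PeriodPair) {a : ℂ}
    (h : 2 * a ∈ L.lattice) : L.derivWeierstrassP a = 0 := by
  have hodd := L.derivWeierstrassP_sub_coe a ⟨2 * a, h⟩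
  rw [show a - ((⟨2 * a, h⟩ : L.lattice) : ℂ) = -a by push_cast; ring,
    L.derivWeierstrassP_neg] at hodd
  exact self_eq_neg.mp hodd.symm

lemma eventually_derivWeierstrassP_ne_zero (L : PeriodPair) (z : ℂ) :
    ∀ᶠ w in 𝓝[≠] z, L.derivWeierstrassP w ≠ 0 := by
  have hmero := L.meromorphic_derivWeierstrassP
  have hpole : meromorphicOrderAt L.derivWeierstrassP 0 = (-3 : ℤ) := by
    rw [← L.deriv_weierstrassP]
    exact meromorphicOrderAt_deriv_eq_sub_one (n := -2) (by norm_num)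
      (L.order_weierstrassP 0 (zero_mem _))
  refine (meromorphicOrderAt_ne_top_iff_eventually_ne_zero (hmero z)).mp ?_
  exact (show MeromorphicOn L.derivWeierstrassP univ from fun x _ ↦ hmero x
    ).meromorphicOrderAt_ne_top_of_isPreconnected isPreconnected_univ (mem_univ 0) (mem_univ z)
    (by rw [hpole]; exact WithTop.coe_ne_top)

lemma derivWeierstrassP_mul_deriv (L : PeriodPair) {z : ℂ} (hz : z ∉ L.lattice) :
    2 * L.derivWeierstrassP z * deriv L.derivWeierstrassP z =
      2 * L.derivWeierstrassP z * (6 * L.weierstrassP z ^ 2 - L.g₂ / 2) := by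
  have hP := hasDerivAt_weierstrassP L hz
  have hlhs := ((L.analyticOnNhd_derivWeierstrassP z hz).differentiableAt.hasDerivAt).pow 2
  have hrhs := (((hP.pow 3).const_mul 4).sub (hP.const_mul L.g₂)).sub_const L.g₃
  have hcubic : L.derivWeierstrassP ^ 2 =ᶠ[𝓝 z]
      fun w ↦ 4 * L.weierstrassP w ^ 3 - L.g₂ * L.weierstrassP w - L.g₃ := by
    filter_upwards [L.isClosed_lattice.isOpen_compl.mem_nhds hz] with w hw
      using L.derivWeierstrassP_sq w hw
  have hunique := hlhs.unique (hrhs.congr_of_eventuallyEq hcubic)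
  push_cast at hunique
  linear_combination hunique

lemma hasDerivAt_derivWeierstrassP (L : PeriodPair) {z : ℂ} (hz : z ∉ L.lattice) :
    HasDerivAt L.derivWeierstrassP (6 * L.weierstrassP z ^ 2 - L.g₂ / 2) z := by
  have hP' := L.analyticOnNhd_derivWeierstrassP z hz
  have hP := (L.analyticOnNhd_weierstrassP z hz).continuousAt
  have heq : deriv L.derivWeierstrassP =ᶠ[𝓝 z] fun w ↦ 6 * L.weierstrassP w ^ 2 - L.g₂ / 2 := by
    refine (hP'.deriv.continuousAt.eventuallyEq_nhds_iff_eventuallyEq_nhdsNE (by fun_prop)).mp ?_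
    filter_upwards [eventually_notMem_lattice L z, eventually_derivWeierstrassP_ne_zero L z]
      with w hw hw'
    exact mul_left_cancel₀ (mul_ne_zero two_ne_zero hw') (derivWeierstrassP_mul_deriv L hw)
  rw [← heq.eq_of_nhds]
  exact hP'.differentiableAt.hasDerivAt

end WeierstrassP

section AdditionFormula

theorem exists_eventuallyEq_const_of_periodic (L : PeriodPair) {f : ℂ → ℂ} (hf : Meromorphic f)
    (hord : ∀ x, 0 ≤ meromorphicOrderAt f x) (hper : ∀ l ∈ L.lattice, Function.Periodic f l) :
    ∃ c, ∀ x, f =ᶠ[𝓝[≠] x] fun _ ↦ c := by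
  have hf' : MeromorphicOn f univ := fun x _ ↦ hf x
  set F := toMeromorphicNFOn f univ
  have hFf (x : ℂ) : F =ᶠ[𝓝[≠] x] f := hf'.toMeromorphicNFOn_eq_self_on_nhdsNE (mem_univ x)
  have hF (x : ℂ) : AnalyticAt ℂ F x :=
    (meromorphicNFOn_toMeromorphicNFOn f univ (mem_univ x)
      ).meromorphicOrderAt_nonneg_iff_analyticAt.mp
      ((hord x).trans_eq (meromorphicOrderAt_congr (hFf x)).symm)
  have hFper (x l : ℂ) (hl : l ∈ L.lattice) : F (x + l) = F x := by
    have hshift : Tendsto (· + l) (𝓝[≠] x) (𝓝[≠] (x + l)) :=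
      tendsto_nhdsWithin_iff.mpr ⟨(continuous_add_const l).continuousAt.mono_left
        nhdsWithin_le_nhds, by filter_upwards [self_mem_nhdsWithin] with y hy; simpa using hy⟩
    have hFl : ContinuousAt (fun y ↦ F (y + l)) x :=
      (hF (x + l)).continuousAt.comp_of_eq (by fun_prop) rfl
    refine ((hFl.eventuallyEq_nhds_iff_eventuallyEq_nhdsNE (hF x).continuousAt).mp ?_).eq_of_nhds
    filter_upwards [hshift.eventually (hFf (x + l)), hFf x] with y hy hy'
    rw [hy, hy', hper l hl y]
  have hdiff : Differentiable ℂ F := fun x ↦ (hF x).differentiableAt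
  refine ⟨F 0, fun x ↦ (hFf x).symm.trans (.of_forall fun y ↦ ?_)⟩
  exact hdiff.apply_eq_apply_of_bounded (IsZLattice.isCompact_range_of_periodic L.lattice F
    hdiff.continuous hFper).isBounded y 0

/-- The function `ζ(z - a) - ζ(z + a) + 2 ζ(a)`, which is elliptic in `z` and, by the addition
formula, equals `℘'(a) / (℘(z) - ℘(a))`. -/
noncomputable def zetaDifference (L : PeriodPair) (a z : ℂ) : ℂ :=
  L.weierstrassZeta (z - a) - L.weierstrassZeta (z + a) + 2 * L.weierstrassZeta a

lemma periodic_zetaDifference (L : PeriodPair) (a : ℂ) {l : ℂ} (hl : l ∈ L.lattice) :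
    Function.Periodic (zetaDifference L a) l := by
  intro z
  have h := weierstrassZeta_add_coe L (z - a) ⟨l, hl⟩
  have h' := weierstrassZeta_add_coe L (z + a) ⟨l, hl⟩
  rw [zetaDifference, zetaDifference, add_sub_right_comm, add_right_comm z l a, h, h']
  ring

lemma meromorphicAt_weierstrassZeta_add (L : PeriodPair) (a x : ℂ) :
    MeromorphicAt (fun z ↦ L.weierstrassZeta (z + a)) x :=
  meromorphicAt_fun_comp_add_const_iff_meromorphicAt.mpr (meromorphic_weierstrassZeta L (x + a))

lemma neg_one_le_meromorphicOrderAt_weierstrassZeta_add (L : PeriodPair) (a x : ℂ) :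
    -1 ≤ meromorphicOrderAt (fun z ↦ L.weierstrassZeta (z + a)) x :=
  (neg_one_le_meromorphicOrderAt_weierstrassZeta L (x + a)).trans_eq
    meromorphicOrderAt_fun_comp_add_const_eq_meromorphicOrderAt.symm

lemma zetaDifference_eq_add (L : PeriodPair) (a : ℂ) :
    zetaDifference L a = (fun z ↦ L.weierstrassZeta (z + -a)) +
      -(fun z ↦ L.weierstrassZeta (z + a)) + fun _ ↦ 2 * L.weierstrassZeta a := by
  ext z
  simp [zetaDifference, sub_eq_add_neg]

lemma meromorphic_zetaDifference (L : PeriodPair) (a : ℂ) : Meromorphic (zetaDifference L a) := by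
  intro x
  rw [zetaDifference_eq_add]
  exact ((meromorphicAt_weierstrassZeta_add L (-a) x).add
    (meromorphicAt_weierstrassZeta_add L a x).neg).add (.const _ x)

lemma neg_one_le_meromorphicOrderAt_zetaDifference (L : PeriodPair) (a x : ℂ) :
    -1 ≤ meromorphicOrderAt (zetaDifference L a) x := by
  have hsub := meromorphicAt_weierstrassZeta_add L (-a) x
  have hadd := (meromorphicAt_weierstrassZeta_add L a x).neg
  rw [zetaDifference_eq_add]
  refine (le_min ((le_min ?_ ?_).trans (meromorphicOrderAt_add hsub hadd)) ?_).trans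
    (meromorphicOrderAt_add (hsub.add hadd) (.const _ x))
  · exact neg_one_le_meromorphicOrderAt_weierstrassZeta_add L (-a) x
  · rw [← meromorphicOrderAt_neg]
    exact neg_one_le_meromorphicOrderAt_weierstrassZeta_add L a x
  · exact le_trans (by decide) (analyticAt_const.meromorphicOrderAt_nonneg)

lemma analyticAt_zetaDifference (L : PeriodPair) {a z : ℂ} (h₁ : z - a ∉ L.lattice)
    (h₂ : z + a ∉ L.lattice) : AnalyticAt ℂ (zetaDifference L a) z :=
  (((analyticAt_weierstrassZeta L h₁).comp_of_eq (f := (· - a)) (by fun_prop) rfl).sub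
    ((analyticAt_weierstrassZeta L h₂).comp_of_eq (f := (· + a)) (by fun_prop) rfl)).add
    analyticAt_const

lemma hasDerivAt_zetaDifference (L : PeriodPair) {a z : ℂ} (h₁ : z - a ∉ L.lattice)
    (h₂ : z + a ∉ L.lattice) :
    HasDerivAt (zetaDifference L a) (L.weierstrassP (z + a) - L.weierstrassP (z - a)) z := by
  convert! (((hasDerivAt_weierstrassZeta L h₁).comp_sub_const z a).sub
    ((hasDerivAt_weierstrassZeta L h₂).comp_add_const z a)).add_const
    (2 * L.weierstrassZeta a) using 1
  ring

lemma natCast_le_meromorphicOrderAt_of_iteratedDeriv_eq_zero {f : ℂ → ℂ} {x : ℂ} {n : ℕ}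
    (hf : AnalyticAt ℂ f x) (hzero : ∀ i < n, iteratedDeriv i f x = 0) :
    ((n : ℤ) : WithTop ℤ) ≤ meromorphicOrderAt f x := by
  have horder := (natCast_le_analyticOrderAt_iff_iteratedDeriv_eq_zero hf).mpr hzero
  rw [hf.meromorphicOrderAt_eq]
  cases h : analyticOrderAt f x with
  | top => exact le_top
  | coe m =>
    rw [h] at horder
    exact WithTop.coe_le_coe.mpr (Nat.cast_le.mpr (Nat.cast_le.mp horder))

lemma two_le_meromorphicOrderAt_zetaDifference (L : PeriodPair) {a l : ℂ} (ha : a ∉ L.lattice)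
    (hl : l ∈ L.lattice) : 2 ≤ meromorphicOrderAt (zetaDifference L a) l := by
  have hsub : (0 : ℂ) - a ∉ L.lattice := by simpa using ha
  have hadd : (0 : ℂ) + a ∉ L.lattice := by simpa using ha
  have hval : zetaDifference L a 0 = 0 := by
    rw [zetaDifference, zero_sub, zero_add, weierstrassZeta_neg]
    ring
  have hderiv : deriv (zetaDifference L a) 0 = 0 := by
    rw [(hasDerivAt_zetaDifference L hsub hadd).deriv, zero_sub, zero_add, L.weierstrassP_neg,
      sub_self]
  have hshift : meromorphicOrderAt (zetaDifference L a) l =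
      meromorphicOrderAt (zetaDifference L a) 0 := by
    rw [← zero_add l, ← meromorphicOrderAt_comp_add_const_eq_meromorphicOrderAt]
    congr 1
    exact funext (periodic_zetaDifference L a hl)
  rw [hshift]
  refine natCast_le_meromorphicOrderAt_of_iteratedDeriv_eq_zero (n := 2)
    (analyticAt_zetaDifference L hsub hadd) fun i hi ↦ ?_
  interval_cases i
  · simpa using hval
  · simpa using hderiv

lemma one_le_meromorphicOrderAt_weierstrassP_sub (L : PeriodPair) {a x : ℂ}
    (hx : x ∉ L.lattice) (hxa : L.weierstrassP x = L.weierstrassP a) :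
    1 ≤ meromorphicOrderAt (fun z ↦ L.weierstrassP z - L.weierstrassP a) x := by
  refine natCast_le_meromorphicOrderAt_of_iteratedDeriv_eq_zero (n := 1)
    ((L.analyticOnNhd_weierstrassP x hx).sub analyticAt_const) fun i hi ↦ ?_
  interval_cases i
  simpa [sub_eq_zero] using hxa

lemma neg_two_le_meromorphicOrderAt_weierstrassP_sub (L : PeriodPair) {l : ℂ}
    (hl : l ∈ L.lattice) (c : ℂ) :
    -2 ≤ meromorphicOrderAt (fun z ↦ L.weierstrassP z - c) l := by
  refine (le_min (L.order_weierstrassP l hl).ge ?_).trans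
    (meromorphicOrderAt_add (f₂ := fun _ ↦ -c) (L.meromorphic_weierstrassP l) (.const _ l))
  exact le_trans (by decide) analyticAt_const.meromorphicOrderAt_nonneg

lemma weierstrassP_eq_of_sub_mem (L : PeriodPair) {x a : ℂ} (h : x - a ∈ L.lattice) :
    L.weierstrassP x = L.weierstrassP a := by
  simpa using L.weierstrassP_add_coe a ⟨x - a, h⟩

lemma meromorphicOrderAt_weierstrassP_sub_mul_zetaDifference_nonneg (L : PeriodPair) {a : ℂ}
    (ha : a ∉ L.lattice) (x : ℂ) :
    0 ≤ meromorphicOrderAt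
      ((fun z ↦ L.weierstrassP z - L.weierstrassP a) * zetaDifference L a) x := by
  have hmul := meromorphicOrderAt_mul (f := fun z ↦ L.weierstrassP z - L.weierstrassP a)
    ((L.meromorphic_weierstrassP x).sub (.const _ x)) (meromorphic_zetaDifference L a x)
  by_cases hx : x ∈ L.lattice
  · rw [hmul]
    exact le_trans (by decide) (add_le_add (neg_two_le_meromorphicOrderAt_weierstrassP_sub L hx _)
      (two_le_meromorphicOrderAt_zetaDifference L ha hx))
  by_cases hpole : x - a ∈ L.lattice ∨ x + a ∈ L.lattice
  · have hxa : L.weierstrassP x = L.weierstrassP a := by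
      rcases hpole with h | h
      · exact weierstrassP_eq_of_sub_mem L h
      · rw [← L.weierstrassP_neg a]
        exact weierstrassP_eq_of_sub_mem L (by simpa using h)
    rw [hmul]
    exact le_trans (by decide) (add_le_add (one_le_meromorphicOrderAt_weierstrassP_sub L hx hxa)
      (neg_one_le_meromorphicOrderAt_zetaDifference L a x))
  · push Not at hpole
    exact (((L.analyticOnNhd_weierstrassP x hx).sub analyticAt_const).mul
      (analyticAt_zetaDifference L hpole.1 hpole.2)).meromorphicOrderAt_nonneg

lemma tendsto_sub_mul_zetaDifference (L : PeriodPair) {a : ℂ} (ha : 2 * a ∉ L.lattice) :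
    Tendsto (fun z ↦ (z - a) * zetaDifference L a z) (𝓝[≠] a) (𝓝 1) := by
  have hreg : ContinuousAt (fun z ↦ L.weierstrassZeta (z - a) - (z - a)⁻¹) a := by
    simpa [Function.comp_def] using (analyticAt_weierstrassZeta_sub_inv L
      (zero_mem _)).continuousAt.comp_of_eq (f := fun z ↦ z - a) (by fun_prop) (sub_self a)
  have hadd : ContinuousAt (fun z ↦ L.weierstrassZeta (z + a)) a :=
    (analyticAt_weierstrassZeta L (by rwa [← two_mul])).continuousAt.comp_of_eq
      (f := fun z ↦ z + a) (by fun_prop) rfl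
  have hlim : ContinuousAt (fun z ↦ 1 + (z - a) * (L.weierstrassZeta (z - a) - (z - a)⁻¹ -
    L.weierstrassZeta (z + a) + 2 * L.weierstrassZeta a)) a := by fun_prop
  refine Tendsto.congr' ?_ (by simpa using hlim.tendsto.mono_left nhdsWithin_le_nhds)
  filter_upwards [self_mem_nhdsWithin] with z hz
  have hza : z - a ≠ 0 := sub_ne_zero.mpr hz
  rw [zetaDifference]
  field_simp
  ring

lemma tendsto_weierstrassP_sub_mul_zetaDifference (L : PeriodPair) {a : ℂ}
    (ha : 2 * a ∉ L.lattice) :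
    Tendsto ((fun z ↦ L.weierstrassP z - L.weierstrassP a) * zetaDifference L a) (𝓝[≠] a)
      (𝓝 (L.derivWeierstrassP a)) := by
  have ha' : a ∉ L.lattice := fun h ↦ ha (by rw [two_mul]; exact add_mem h h)
  have hmul := (hasDerivAt_weierstrassP L ha').tendsto_slope.mul
    (tendsto_sub_mul_zetaDifference L ha)
  rw [mul_one] at hmul
  refine hmul.congr' ?_
  filter_upwards [self_mem_nhdsWithin] with z hz
  have hza : z - a ≠ 0 := sub_ne_zero.mpr hz
  rw [slope_def_field, Pi.mul_apply]
  field_simp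

theorem weierstrassP_sub_mul_zetaDifference (L : PeriodPair) {a z : ℂ} (ha : 2 * a ∉ L.lattice)
    (hz : z ∉ L.lattice) (h₁ : z - a ∉ L.lattice) (h₂ : z + a ∉ L.lattice) :
    (L.weierstrassP z - L.weierstrassP a) * zetaDifference L a z = L.derivWeierstrassP a := by
  have ha' : a ∉ L.lattice := fun h ↦ ha (by rw [two_mul]; exact add_mem h h)
  set f := (fun z ↦ L.weierstrassP z - L.weierstrassP a) * zetaDifference L a
  obtain ⟨c, hc⟩ := exists_eventuallyEq_const_of_periodic L (f := f)
    (fun x ↦ ((L.meromorphic_weierstrassP x).sub (.const _ x)).mul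
      (meromorphic_zetaDifference L a x))
    (meromorphicOrderAt_weierstrassP_sub_mul_zetaDifference_nonneg L ha')
    fun l hl z ↦ by
      simp only [f, Pi.mul_apply, periodic_zetaDifference L a hl z,
        L.weierstrassP_add_coe z ⟨l, hl⟩]
  have hcont : ContinuousAt f z := (((L.analyticOnNhd_weierstrassP z hz).sub analyticAt_const).mul
    (analyticAt_zetaDifference L h₁ h₂)).continuousAt
  have hca : c = L.derivWeierstrassP a := tendsto_nhds_unique
    (tendsto_const_nhds.congr' (hc a).symm) (tendsto_weierstrassP_sub_mul_zetaDifference L ha)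
  rw [← hca]
  exact ((hcont.eventuallyEq_nhds_iff_eventuallyEq_nhdsNE continuousAt_const).mp
    (hc z)).eq_of_nhds

end AdditionFormula

section RectangularLattice

lemma intCast_mul_notMem_Ioo {p : ℝ} (hp : 0 < p) (n : ℤ) : n * p ∉ Ioo 0 p := by
  rintro ⟨hpos, hlt⟩
  have hn : (0 : ℝ) < n := pos_of_mul_pos_left hpos hp.le
  have hn' : (n : ℝ) < 1 := lt_of_mul_lt_mul_right (by simpa using hlt) hp.le
  norm_cast at hn hn'
  omega

/-- The period lattice of `L` is the rectangular lattice `2 ω ℤ + 2 i τ ℤ`. -/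
structure IsRectangular (L : PeriodPair) (ω τ : ℝ) : Prop where
  ω_pos : 0 < ω
  τ_pos : 0 < τ
  ω₁_eq : L.ω₁ = 2 * ω
  ω₂_eq : L.ω₂ = 2 * (I * τ)

namespace IsRectangular

variable {L : PeriodPair} {ω τ : ℝ}

lemma exists_re_im_eq (h : IsRectangular L ω τ) {z : ℂ} (hz : z ∈ L.lattice) :
    ∃ m n : ℤ, z.re = m * (2 * ω) ∧ z.im = n * (2 * τ) := by
  obtain ⟨m, n, rfl⟩ := PeriodPair.mem_lattice.mp hz
  exact ⟨m, n, by simp [h.ω₁_eq, h.ω₂_eq], by simp [h.ω₁_eq, h.ω₂_eq]⟩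

lemma notMem_of_im_mem_Ioo (h : IsRectangular L ω τ) {z : ℂ} (hz : z.im ∈ Ioo 0 (2 * τ)) :
    z ∉ L.lattice := by
  intro hmem
  obtain ⟨-, n, -, hn⟩ := h.exists_re_im_eq hmem
  exact intCast_mul_notMem_Ioo (mul_pos two_pos h.τ_pos) n (hn ▸ hz)

lemma notMem_of_re_mem_Ioo (h : IsRectangular L ω τ) {z : ℂ} (hz : z.re ∈ Ioo 0 (2 * ω)) :
    z ∉ L.lattice := by
  intro hmem
  obtain ⟨m, -, hm, -⟩ := h.exists_re_im_eq hmem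
  exact intCast_mul_notMem_Ioo (mul_pos two_pos h.ω_pos) m (hm ▸ hz)

end IsRectangular

lemma continuousOn_weierstrassZeta (L : PeriodPair) :
    ContinuousOn L.weierstrassZeta (L.lattice : Set ℂ)ᶜ := fun _ hz ↦
  (hasDerivAt_weierstrassZeta L hz).continuousAt.continuousWithinAt

lemma continuousOn_weierstrassP (L : PeriodPair) :
    ContinuousOn L.weierstrassP (L.lattice : Set ℂ)ᶜ :=
  L.differentiableOn_weierstrassP.continuousOn

end RectangularLattice

section HorizontalIntegral

lemma hasDerivAt_integral_comp_add_ofReal {f f' : ℂ → ℂ} {S : Set ℂ} (hS : IsOpen S)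
    (hadd : ∀ z ∈ S, ∀ s : ℝ, z + s ∈ S) (hf : ∀ z ∈ S, HasDerivAt f (f' z) z)
    (hf' : ContinuousOn f' S) (a b : ℝ) {z : ℂ} (hz : z ∈ S) :
    HasDerivAt (fun z ↦ ∫ s in a..b, f (z + s)) (f (z + b) - f (z + a)) z := by
  have hcont {g : ℂ → ℂ} (hg : ContinuousOn g S) {w : ℂ} (hw : w ∈ S) :
      Continuous fun s : ℝ ↦ g (w + s) := hg.comp_continuous (by fun_prop) (hadd w hw)
  have hfS : ContinuousOn f S := HasDerivAt.continuousOn hf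
  obtain ⟨r, hr, hrS⟩ := Metric.nhds_basis_closedBall.mem_iff.mp (hS.mem_nhds hz)
  have hball : Metric.closedBall z r ∈ 𝓝 z := Metric.closedBall_mem_nhds z hr
  obtain ⟨C, hC⟩ := ((isCompact_closedBall z r).prod isCompact_uIcc).exists_bound_of_continuousOn
    (f := fun q : ℂ × ℝ ↦ f' (q.1 + q.2)) (s := Metric.closedBall z r ×ˢ uIcc a b)
    (hf'.comp (by fun_prop) fun q hq ↦ hadd _ (hrS hq.1) _)
  have hparam := (intervalIntegral.hasDerivAt_integral_of_dominated_loc_of_deriv_le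
    (μ := volume) (F := fun w (s : ℝ) ↦ f (w + s)) (F' := fun w (s : ℝ) ↦ f' (w + s))
    (bound := fun _ ↦ C) hball
    (by filter_upwards [hball] with w hw using (hcont hfS (hrS hw)).aestronglyMeasurable)
    ((hcont hfS hz).intervalIntegrable a b) (hcont hf' hz).aestronglyMeasurable
    (.of_forall fun s hs w hw ↦ hC (w, s) ⟨hw, uIoc_subset_uIcc hs⟩) intervalIntegrable_const
    (.of_forall fun s _ w hw ↦ (hf _ (hadd w (hrS hw) s)).comp_add_const w s)).2
  rwa [intervalIntegral.integral_eq_sub_of_hasDerivAt (f := fun s : ℝ ↦ f (z + s))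
    (fun s _ ↦ ((hf _ (hadd z hz s)).comp_const_add z s).comp_ofReal)
    ((hcont hf' hz).intervalIntegrable a b)] at hparam

namespace IsRectangular

variable {L : PeriodPair} {ω τ : ℝ}

lemma continuous_comp_add_ofReal (h : IsRectangular L ω τ) {f : ℂ → ℂ}
    (hf : ContinuousOn f (L.lattice : Set ℂ)ᶜ) {z : ℂ} (hz : z.im ∈ Ioo 0 (2 * τ)) :
    Continuous fun s : ℝ ↦ f (z + s) :=
  hf.comp_continuous (by fun_prop) fun s ↦ h.notMem_of_im_mem_Ioo (by simpa using hz)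

lemma weierstrassZeta_add_two_mul (h : IsRectangular L ω τ) (z : ℂ) :
    L.weierstrassZeta (z + 2 * ω) = L.weierstrassZeta z + 2 * L.weierstrassZeta ω := by
  have hadd := weierstrassZeta_add_coe L z ⟨L.ω₁, L.ω₁_mem_lattice⟩
  have hhalf := weierstrassZeta_ω₁ L
  simp only [h.ω₁_eq, mul_div_cancel_left₀ _ (two_ne_zero (α := ℂ))] at hadd hhalf
  rw [hadd, hhalf]

lemma integral_weierstrassZeta_sub (h : IsRectangular L ω τ) {z w : ℂ}
    (hz : z.im ∈ Ioo 0 (2 * τ)) (hw : w.im ∈ Ioo 0 (2 * τ)) :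
    (∫ s in (0 : ℝ)..(2 * ω), L.weierstrassZeta (z + s)) -
      ∫ s in (0 : ℝ)..(2 * ω), L.weierstrassZeta (w + s) = 2 * L.weierstrassZeta ω * (z - w) := by
  set S : Set ℂ := im ⁻¹' Ioo 0 (2 * τ)
  have hS : IsOpen S := isOpen_Ioo.preimage continuous_im
  have hSconv : Convex ℝ S := (convex_Ioo 0 (2 * τ)).linear_preimage imLm
  have hSΛ {x : ℂ} (hx : x ∈ S) : x ∉ L.lattice := h.notMem_of_im_mem_Ioo hx
  have hderiv : ∀ x ∈ S, HasDerivAt (fun z ↦ (∫ s in (0 : ℝ)..(2 * ω), L.weierstrassZeta (z + s)) -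
      2 * L.weierstrassZeta ω * z) 0 x := by
    intro x hx
    convert! (hasDerivAt_integral_comp_add_ofReal hS (fun z hz s ↦ by simpa [S] using hz)
      (fun z hz ↦ hasDerivAt_weierstrassZeta L (hSΛ hz))
      ((continuousOn_weierstrassP L).neg.mono fun z hz ↦ hSΛ hz) 0 (2 * ω) hx).sub
      ((hasDerivAt_id x).const_mul (2 * L.weierstrassZeta ω)) using 1
    push_cast
    rw [h.weierstrassZeta_add_two_mul, add_zero]
    ring
  have hconst := hS.is_const_of_deriv_eq_zero hSconv.isPreconnected
    (fun x hx ↦ (hderiv x hx).differentiableAt.differentiableWithinAt)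
    (fun x hx ↦ (hderiv x hx).deriv) hz hw
  linear_combination hconst

lemma weierstrassP_sub_mul_zeta_horizontal (h : IsRectangular L ω τ) {α : ℂ} (hα : |α.im| < τ)
    (hα' : L.derivWeierstrassP α ≠ 0) (s : ℝ) :
    (L.weierstrassP (I * τ + s) - L.weierstrassP α) *
      (L.weierstrassZeta (I * τ - α + s) - L.weierstrassZeta (I * τ + α + s) +
        2 * L.weierstrassZeta α) = L.derivWeierstrassP α := by
  obtain ⟨hlower, hupper⟩ := abs_lt.mp hα
  have h2α : 2 * α ∉ L.lattice := fun hmem ↦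
    hα' (derivWeierstrassP_eq_zero_of_two_mul_mem L hmem)
  rw [← weierstrassP_sub_mul_zetaDifference L h2α (z := I * τ + s), zetaDifference,
    sub_add_eq_add_sub (I * (τ : ℂ)), add_right_comm (I * (τ : ℂ)) α]
  all_goals exact h.notMem_of_im_mem_Ioo ⟨by simp; linarith, by simp; linarith⟩

theorem integral_inv_weierstrassP_sub (h : IsRectangular L ω τ) {α : ℂ} (hα : |α.im| < τ)
    (hα' : L.derivWeierstrassP α ≠ 0) :
    ∫ s in (0 : ℝ)..(2 * ω), (L.weierstrassP (I * τ + s) - L.weierstrassP α)⁻¹ =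
      zetaTerm L ω α := by
  obtain ⟨hlower, hupper⟩ := abs_lt.mp hα
  have hsub : (I * τ - α).im ∈ Ioo 0 (2 * τ) := ⟨by simp; linarith, by simp; linarith⟩
  have hadd : (I * τ + α).im ∈ Ioo 0 (2 * τ) := ⟨by simp; linarith, by simp; linarith⟩
  have hint {w : ℂ} (hw : w.im ∈ Ioo 0 (2 * τ)) :
      IntervalIntegrable (fun s : ℝ ↦ L.weierstrassZeta (w + s)) volume 0 (2 * ω) :=
    (h.continuous_comp_add_ofReal (continuousOn_weierstrassZeta L) hw).intervalIntegrable _ _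
  have hinv (s : ℝ) : (L.weierstrassP (I * τ + s) - L.weierstrassP α)⁻¹ =
      (L.derivWeierstrassP α)⁻¹ * (L.weierstrassZeta (I * τ - α + s) -
        L.weierstrassZeta (I * τ + α + s) + 2 * L.weierstrassZeta α) := by
    have hmul := h.weierstrassP_sub_mul_zeta_horizontal hα hα' s
    have hne := right_ne_zero_of_mul (hmul.trans_ne hα')
    rw [← hmul, mul_inv, inv_mul_cancel_right₀ hne]
  simp_rw [hinv]
  rw [intervalIntegral.integral_const_mul, intervalIntegral.integral_add
    ((hint hsub).sub (hint hadd)) intervalIntegrable_const,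
    intervalIntegral.integral_sub (hint hsub) (hint hadd), h.integral_weierstrassZeta_sub hsub hadd,
    intervalIntegral.integral_const, zetaTerm]
  simp only [sub_zero, real_smul]
  push_cast
  field

end IsRectangular

end HorizontalIntegral

section Gap

lemma le_of_isPreconnected_of_notMem_Ioo {X α : Type*} [TopologicalSpace X] [TopologicalSpace α]
    [LinearOrder α] [DenselyOrdered α] [OrderClosedTopology α] {S : Set X}
    (hS : IsPreconnected S) {f : X → α} (hf : ContinuousOn f S) {a b : α} (hab : a < b)
    (hgap : ∀ t ∈ S, f t ∉ Ioo a b) {x y : X} (hx : x ∈ S) (hy : y ∈ S) (hxa : f x ≤ a) :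
    f y ≤ a := by
  by_contra! hya
  obtain ⟨c, hac, hc⟩ := exists_between (lt_min hab hya)
  obtain ⟨t, ht, rfl⟩ := hS.intermediate_value hx hy hf
    ⟨hxa.trans hac.le, (hc.trans_le (min_le_right _ _)).le⟩
  exact hgap t ht ⟨hac, hc.trans_le (min_le_left _ _)⟩

lemma ge_of_isPreconnected_of_notMem_Ioo {X α : Type*} [TopologicalSpace X] [TopologicalSpace α]
    [LinearOrder α] [DenselyOrdered α] [OrderClosedTopology α] {S : Set X}
    (hS : IsPreconnected S) {f : X → α} (hf : ContinuousOn f S) {a b : α} (hab : a < b)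
    (hgap : ∀ t ∈ S, f t ∉ Ioo a b) {x y : X} (hx : x ∈ S) (hy : y ∈ S) (hxb : b ≤ f x) :
    b ≤ f y :=
  le_of_isPreconnected_of_notMem_Ioo (α := αᵒᵈ) hS hf (a := b) (b := a) hab
    (fun t ht h ↦ hgap t ht ⟨h.2, h.1⟩) hx hy hxb

lemma four_mul_cubic_neg_iff {a b c x : ℝ} (hab : b < a) (hbc : c < b) :
    4 * (x - a) * (x - b) * (x - c) < 0 ↔ x < c ∨ x ∈ Ioo b a := by
  simp only [mul_neg_iff, mul_pos_iff, sub_neg, sub_pos, mem_Ioo]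
  grind

lemma four_mul_cubic_pos_iff {a b c x : ℝ} (hab : b < a) (hbc : c < b) :
    0 < 4 * (x - a) * (x - b) * (x - c) ↔ x ∈ Ioo c b ∨ a < x := by
  simp only [mul_neg_iff, mul_pos_iff, sub_neg, sub_pos, mem_Ioo]
  grind

end Gap

section RealValues

lemma tendsto_weierstrassP_sub_inv_sq (L : PeriodPair) :
    Tendsto (fun z ↦ L.weierstrassP z - (z ^ 2)⁻¹) (𝓝 0) (𝓝 0) := by
  have hexcept := (L.analyticAt_weierstrassPExcept 0).continuousAt.tendsto
  rw [L.weierstrassPExcept_zero] at hexcept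
  refine hexcept.congr fun z ↦ ?_
  simp [← L.weierstrassPExcept_add 0 z]

lemma tendsto_inv_sq_nhdsGT_zero : Tendsto (fun t : ℝ ↦ (t ^ 2)⁻¹) (𝓝[>] 0) atTop := by
  simpa only [inv_pow, Function.comp_def] using
    (tendsto_pow_atTop (α := ℝ) two_ne_zero).comp tendsto_inv_nhdsGT_zero

lemma tendsto_weierstrassP_mul_ofReal_sub (L : PeriodPair) (c : ℂ) :
    Tendsto (fun t : ℝ ↦ (L.weierstrassP (c * t) - ((c * t) ^ 2)⁻¹).re) (𝓝[>] 0) (𝓝 0) := by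
  have hline : Tendsto (fun t : ℝ ↦ c * t) (𝓝[>] 0) (𝓝 0) := by
    have hcont : Continuous fun t : ℝ ↦ c * (t : ℂ) := by fun_prop
    simpa using hcont.tendsto 0 |>.mono_left nhdsWithin_le_nhds
  exact (continuous_re.tendsto 0).comp ((tendsto_weierstrassP_sub_inv_sq L).comp hline)

lemma tendsto_re_weierstrassP_ofReal (L : PeriodPair) :
    Tendsto (fun t : ℝ ↦ (L.weierstrassP t).re) (𝓝[>] 0) atTop := by
  refine ((tendsto_weierstrassP_mul_ofReal_sub L 1).add_atTop tendsto_inv_sq_nhdsGT_zero).congr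
    fun t ↦ ?_
  simp [← ofReal_pow, ← ofReal_inv]

lemma tendsto_re_weierstrassP_I_mul_ofReal (L : PeriodPair) :
    Tendsto (fun t : ℝ ↦ (L.weierstrassP (I * t)).re) (𝓝[>] 0) atBot := by
  refine ((tendsto_weierstrassP_mul_ofReal_sub L I).add_atBot
    (tendsto_neg_atTop_atBot.comp tendsto_inv_sq_nhdsGT_zero)).congr fun t ↦ ?_
  simp [mul_pow, ← ofReal_pow, ← ofReal_inv, inv_neg]

lemma im_mul_deriv_eq_zero_of_line {f : ℂ → ℂ} {z c f' : ℂ} (hf : HasDerivAt f f' z)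
    (hreal : ∀ t : ℝ, (f (z + c * t)).im = 0) : (c * f').im = 0 := by
  have hline : HasDerivAt (fun t : ℂ ↦ z + c * t) c ((0 : ℝ) : ℂ) := by
    simpa using ((hasDerivAt_id ((0 : ℝ) : ℂ)).const_mul c).const_add z
  have hcomp : HasDerivAt (fun t : ℝ ↦ f (z + c * t)) (f' * c) 0 :=
    (HasDerivAt.comp_of_eq (h₂ := f) (y := z) _ hf hline (by simp)).comp_ofReal
  have him := imCLM.hasFDerivAt.comp_hasDerivAt (0 : ℝ) hcomp
  rw [show (imCLM ∘ fun t : ℝ ↦ f (z + c * t)) = fun _ ↦ (0 : ℝ) from funext hreal] at him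
  rw [mul_comm]
  exact him.unique (hasDerivAt_const _ _)

lemma continuousOn_re_weierstrassP_comp (L : PeriodPair) {S : Set ℝ} {f : ℝ → ℂ}
    (hf : Continuous f) (hS : ∀ t ∈ S, f t ∉ L.lattice) :
    ContinuousOn (fun t ↦ (L.weierstrassP (f t)).re) S :=
  continuous_re.comp_continuousOn ((continuousOn_weierstrassP L).comp hf.continuousOn hS)

namespace IsRectangular

variable {L : PeriodPair} {ω τ : ℝ}

lemma conj_mem_lattice (h : IsRectangular L ω τ) {z : ℂ} (hz : z ∈ L.lattice) :
    conj z ∈ L.lattice := by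
  obtain ⟨m, n, rfl⟩ := PeriodPair.mem_lattice.mp hz
  exact PeriodPair.mem_lattice.mpr ⟨m, -n, by simp [h.ω₁_eq, h.ω₂_eq, conj_ofNat]⟩

lemma weierstrassP_conj (h : IsRectangular L ω τ) (z : ℂ) :
    L.weierstrassP (conj z) = conj (L.weierstrassP z) := by
  let e : L.lattice ≃ L.lattice :=
    { toFun := fun l ↦ ⟨_, h.conj_mem_lattice l.2⟩
      invFun := fun l ↦ ⟨_, h.conj_mem_lattice l.2⟩
      left_inv := fun l ↦ by simp
      right_inv := fun l ↦ by simp }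
  rw [PeriodPair.weierstrassP, PeriodPair.weierstrassP, conj_tsum, ← e.tsum_eq]
  congr with l
  simp [e]

lemma weierstrassP_im_eq_zero (h : IsRectangular L ω τ) {z : ℂ}
    (hz : conj z - z ∈ L.lattice ∨ conj z + z ∈ L.lattice) : (L.weierstrassP z).im = 0 := by
  rw [← conj_eq_iff_im, ← h.weierstrassP_conj]
  rcases hz with hz | hz
  · exact weierstrassP_eq_of_sub_mem L hz
  · rw [← L.weierstrassP_neg z]
    exact weierstrassP_eq_of_sub_mem L (by simpa using hz)

lemma two_mul_ω_mem (h : IsRectangular L ω τ) : (2 * ω : ℂ) ∈ L.lattice :=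
  h.ω₁_eq ▸ L.ω₁_mem_lattice

lemma two_mul_I_mul_τ_mem (h : IsRectangular L ω τ) : 2 * (I * τ) ∈ L.lattice :=
  h.ω₂_eq ▸ L.ω₂_mem_lattice

lemma weierstrassP_ofReal_im (h : IsRectangular L ω τ) (t : ℝ) : (L.weierstrassP t).im = 0 :=
  h.weierstrassP_im_eq_zero (.inl (by simp))

lemma weierstrassP_I_mul_ofReal_im (h : IsRectangular L ω τ) (t : ℝ) :
    (L.weierstrassP (I * t)).im = 0 :=
  h.weierstrassP_im_eq_zero (.inr (by simp))

lemma weierstrassP_I_mul_τ_add_im (h : IsRectangular L ω τ) (t : ℝ) :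
    (L.weierstrassP (I * τ + t)).im = 0 := by
  refine h.weierstrassP_im_eq_zero (.inl ?_)
  convert! neg_mem h.two_mul_I_mul_τ_mem using 1
  simp only [map_add, map_mul, conj_I, conj_ofReal]
  ring

lemma weierstrassP_ω_add_I_mul_im (h : IsRectangular L ω τ) (t : ℝ) :
    (L.weierstrassP (ω + I * t)).im = 0 := by
  refine h.weierstrassP_im_eq_zero (.inr ?_)
  convert! h.two_mul_ω_mem using 1
  simp only [map_add, map_mul, conj_I, conj_ofReal]
  ring

lemma I_mul_τ_add_notMem (h : IsRectangular L ω τ) (t : ℝ) : I * τ + t ∉ L.lattice :=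
  h.notMem_of_im_mem_Ioo (by simp [h.τ_pos])

lemma ω_add_I_mul_notMem (h : IsRectangular L ω τ) (t : ℝ) : ω + I * t ∉ L.lattice :=
  h.notMem_of_re_mem_Ioo (by simp [h.ω_pos])

lemma I_mul_notMem (h : IsRectangular L ω τ) {t : ℝ} (ht : t ∈ Ioo 0 (2 * τ)) :
    I * t ∉ L.lattice :=
  h.notMem_of_im_mem_Ioo (by simpa using ht)

lemma ofReal_notMem (h : IsRectangular L ω τ) {t : ℝ} (ht : t ∈ Ioo 0 (2 * ω)) :
    (t : ℂ) ∉ L.lattice :=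
  h.notMem_of_re_mem_Ioo (by simpa using ht)

end IsRectangular

end RealValues

section HalfPeriods

/-- The Weierstrass cubic `4 x³ - g₂ x - g₃` of `L` has the real roots `e₁ > e₂ > e₃`. -/
structure HasRealRoots (L : PeriodPair) (e₁ e₂ e₃ : ℝ) : Prop where
  cubic : ∀ x : ℂ, 4 * x ^ 3 - L.g₂ * x - L.g₃ = 4 * (x - e₁) * (x - e₂) * (x - e₃)
  lt₁₂ : e₂ < e₁
  lt₂₃ : e₃ < e₂

namespace HasRealRoots

variable {L : PeriodPair} {ω τ e₁ e₂ e₃ : ℝ}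

lemma weierstrassP_eq_of_two_mul_mem (he : HasRealRoots L e₁ e₂ e₃) {z : ℂ} (hz : z ∉ L.lattice)
    (h2z : 2 * z ∈ L.lattice) :
    L.weierstrassP z = e₁ ∨ L.weierstrassP z = e₂ ∨ L.weierstrassP z = e₃ := by
  have hsq := L.derivWeierstrassP_sq z hz
  rw [derivWeierstrassP_eq_zero_of_two_mul_mem L h2z, he.cubic] at hsq
  simpa [sub_eq_zero, or_assoc] using hsq.symm

/- If `℘` is real on the line `z + ℝ c`, then so is `c ℘'(z)`, and `(c ℘'(z))²` is `k` times the
value of the cubic. -/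
lemma mul_cubic_nonneg_of_line (he : HasRealRoots L e₁ e₂ e₃) {z c : ℂ} (hz : z ∉ L.lattice)
    (hreal : ∀ t : ℝ, (L.weierstrassP (z + c * t)).im = 0) {k : ℝ} (hc : c ^ 2 = k) :
    0 ≤ k * (4 * ((L.weierstrassP z).re - e₁) * ((L.weierstrassP z).re - e₂) *
      ((L.weierstrassP z).re - e₃)) := by
  have hderiv : ((c * L.derivWeierstrassP z).re : ℂ) = c * L.derivWeierstrassP z :=
    Complex.ext rfl (im_mul_deriv_eq_zero_of_line (hasDerivAt_weierstrassP L hz) hreal).symm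
  have hP : ((L.weierstrassP z).re : ℂ) = L.weierstrassP z :=
    Complex.ext rfl (by simpa using (hreal 0).symm)
  have hsq : (((c * L.derivWeierstrassP z).re ^ 2 : ℝ) : ℂ) =
      (k * (4 * ((L.weierstrassP z).re - e₁) * ((L.weierstrassP z).re - e₂) *
        ((L.weierstrassP z).re - e₃)) : ℝ) := by
    push_cast
    rw [hderiv, hP, mul_pow, L.derivWeierstrassP_sq z hz, he.cubic, hc]
  rw [← ofReal_inj.mp hsq]
  positivity

lemma re_weierstrassP_notMem_Ioo_of_line (he : HasRealRoots L e₁ e₂ e₃) {z : ℂ}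
    (hz : z ∉ L.lattice) (hreal : ∀ t : ℝ, (L.weierstrassP (z + t)).im = 0) :
    (L.weierstrassP z).re ∉ Ioo e₂ e₁ := by
  intro hmem
  have hneg := (four_mul_cubic_neg_iff he.lt₁₂ he.lt₂₃).mpr (.inr hmem)
  have hnonneg := he.mul_cubic_nonneg_of_line (c := 1) (k := 1) hz (by simpa using hreal) (by simp)
  linarith

lemma re_weierstrassP_notMem_Ioo_of_I_line (he : HasRealRoots L e₁ e₂ e₃) {z : ℂ}
    (hz : z ∉ L.lattice) (hreal : ∀ t : ℝ, (L.weierstrassP (z + I * t)).im = 0) :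
    (L.weierstrassP z).re ∉ Ioo e₃ e₂ := by
  intro hmem
  have hpos := (four_mul_cubic_pos_iff he.lt₁₂ he.lt₂₃).mpr (.inl hmem)
  have hnonpos := he.mul_cubic_nonneg_of_line (c := I) (k := -1) hz hreal (by simp)
  linarith

lemma weierstrassP_ω (he : HasRealRoots L e₁ e₂ e₃) (h : IsRectangular L ω τ) :
    L.weierstrassP ω = e₁ := by
  have hω : ω ∈ Ioo 0 (2 * ω) := ⟨h.ω_pos, by linarith [h.ω_pos]⟩
  obtain ⟨s, hse, hs⟩ := (((tendsto_re_weierstrassP_ofReal L).eventually_ge_atTop e₁).and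
    (Ioo_mem_nhdsGT (hω.1.trans hω.2))).exists
  have hle : e₁ ≤ (L.weierstrassP ω).re := ge_of_isPreconnected_of_notMem_Ioo isPreconnected_Ioo
    (continuousOn_re_weierstrassP_comp L continuous_ofReal fun t ↦ h.ofReal_notMem) he.lt₁₂
    (fun t ht ↦ he.re_weierstrassP_notMem_Ioo_of_line (h.ofReal_notMem ht)
      fun s ↦ mod_cast h.weierstrassP_ofReal_im (t + s)) hs hω hse
  have hlt₁₂ := he.lt₁₂
  have hlt₂₃ := he.lt₂₃
  rcases he.weierstrassP_eq_of_two_mul_mem (h.ofReal_notMem hω) h.two_mul_ω_mem with heq | heq | heq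
  · exact heq
  all_goals rw [heq, ofReal_re] at hle; linarith

lemma weierstrassP_I_mul_τ (he : HasRealRoots L e₁ e₂ e₃) (h : IsRectangular L ω τ) :
    L.weierstrassP (I * τ) = e₃ := by
  have hτ : τ ∈ Ioo 0 (2 * τ) := ⟨h.τ_pos, by linarith [h.τ_pos]⟩
  obtain ⟨s, hse, hs⟩ := (((tendsto_re_weierstrassP_I_mul_ofReal L).eventually_le_atBot e₃).and
    (Ioo_mem_nhdsGT (hτ.1.trans hτ.2))).exists
  have hle : (L.weierstrassP (I * τ)).re ≤ e₃ :=
    le_of_isPreconnected_of_notMem_Ioo isPreconnected_Ioo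
    (continuousOn_re_weierstrassP_comp L (f := fun t : ℝ ↦ I * t) (by fun_prop)
      fun t ↦ h.I_mul_notMem) he.lt₂₃
    (fun t ht ↦ he.re_weierstrassP_notMem_Ioo_of_I_line (h.I_mul_notMem ht)
      fun s ↦ by simpa [mul_add] using h.weierstrassP_I_mul_ofReal_im (t + s)) hs hτ hse
  have hlt₁₂ := he.lt₁₂
  have hlt₂₃ := he.lt₂₃
  rcases he.weierstrassP_eq_of_two_mul_mem (h.I_mul_notMem hτ) h.two_mul_I_mul_τ_mem
    with heq | heq | heq
  on_goal 3 => exact heq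
  all_goals rw [heq, ofReal_re] at hle; linarith

lemma weierstrassP_ω_add_I_mul_τ (he : HasRealRoots L e₁ e₂ e₃) (h : IsRectangular L ω τ) :
    L.weierstrassP (ω + I * τ) = e₂ := by
  have hle : (L.weierstrassP (I * τ + ω)).re ≤ e₂ :=
    le_of_isPreconnected_of_notMem_Ioo isPreconnected_univ
    (continuousOn_re_weierstrassP_comp L (f := fun t : ℝ ↦ I * τ + t) (by fun_prop)
      fun t _ ↦ h.I_mul_τ_add_notMem t) he.lt₁₂
    (fun t _ ↦ he.re_weierstrassP_notMem_Ioo_of_line (h.I_mul_τ_add_notMem t)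
      fun s ↦ by simpa [add_assoc] using h.weierstrassP_I_mul_τ_add_im (t + s))
    (mem_univ 0) (mem_univ ω) (by simpa [he.weierstrassP_I_mul_τ h] using he.lt₂₃.le)
  have hge : e₂ ≤ (L.weierstrassP (ω + I * τ)).re :=
    ge_of_isPreconnected_of_notMem_Ioo isPreconnected_univ
    (continuousOn_re_weierstrassP_comp L (f := fun t : ℝ ↦ ω + I * t) (by fun_prop)
      fun t _ ↦ h.ω_add_I_mul_notMem t) he.lt₂₃
    (fun t _ ↦ he.re_weierstrassP_notMem_Ioo_of_I_line (h.ω_add_I_mul_notMem t)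
      fun s ↦ by simpa [mul_add, add_assoc] using h.weierstrassP_ω_add_I_mul_im (t + s))
    (mem_univ 0) (mem_univ τ) (by simpa [he.weierstrassP_ω h] using he.lt₁₂.le)
  rw [add_comm] at hle
  exact Complex.ext (by simpa using le_antisymm hle hge)
    (by simpa using h.weierstrassP_ω_add_I_mul_im τ)

lemma exists_weierstrassP_eq_of_lt (he : HasRealRoots L e₁ e₂ e₃) (h : IsRectangular L ω τ)
    {x : ℝ} (hx : x < e₃) : ∃ α : ℂ, α ∉ L.lattice ∧ |α.im| < τ ∧ L.weierstrassP α = x := by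
  have hτ := h.τ_pos
  have hnot (t : ℝ) (ht : t ∈ Ioc 0 τ) : I * t ∉ L.lattice :=
    h.I_mul_notMem ⟨ht.1, by linarith [ht.2]⟩
  obtain ⟨s, hsx, hs⟩ := (((tendsto_re_weierstrassP_I_mul_ofReal L).eventually_le_atBot x).and
    (Ioc_mem_nhdsGT hτ)).exists
  obtain ⟨t, ht, htx⟩ := isPreconnected_Ioc.intermediate_value hs (right_mem_Ioc.mpr hτ)
    (continuousOn_re_weierstrassP_comp L (f := fun t : ℝ ↦ I * t) (by fun_prop) hnot)
    (show x ∈ Icc _ _ from ⟨hsx, by simpa [he.weierstrassP_I_mul_τ h] using hx.le⟩)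
  have htτ : t ≠ τ := by
    rintro rfl
    simp only [he.weierstrassP_I_mul_τ h, ofReal_re] at htx
    exact hx.ne' htx
  refine ⟨I * t, hnot t ht, ?_, Complex.ext (by simpa using htx)
    (by simpa using h.weierstrassP_I_mul_ofReal_im t)⟩
  simpa [abs_of_pos ht.1] using lt_of_le_of_ne ht.2 htτ

lemma exists_weierstrassP_eq_of_mem_Ioo (he : HasRealRoots L e₁ e₂ e₃) (h : IsRectangular L ω τ)
    {x : ℝ} (hx : x ∈ Ioo e₂ e₁) :
    ∃ α : ℂ, α ∉ L.lattice ∧ |α.im| < τ ∧ L.weierstrassP α = x := by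
  have hτ := h.τ_pos
  obtain ⟨t, ht, htx⟩ := (isPreconnected_Icc (a := 0) (b := τ)).intermediate_value
    (right_mem_Icc.mpr hτ.le) (left_mem_Icc.mpr hτ.le)
    (continuousOn_re_weierstrassP_comp L (f := fun t : ℝ ↦ ω + I * t) (by fun_prop)
      fun t _ ↦ h.ω_add_I_mul_notMem t)
    (show x ∈ Icc _ _ from ⟨by simpa [he.weierstrassP_ω_add_I_mul_τ h] using hx.1.le,
      by simpa [he.weierstrassP_ω h] using hx.2.le⟩)
  have htτ : t ≠ τ := by
    rintro rfl
    simp only [he.weierstrassP_ω_add_I_mul_τ h, ofReal_re] at htx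
    exact hx.1.ne htx
  refine ⟨ω + I * t, h.ω_add_I_mul_notMem t, ?_, Complex.ext (by simpa using htx)
    (by simpa using h.weierstrassP_ω_add_I_mul_im t)⟩
  simpa [abs_of_nonneg ht.1] using lt_of_le_of_ne ht.2 htτ

end HasRealRoots

end HalfPeriods

section ODE

open scoped Manifold in
lemma eq_of_hasDerivAt_of_contDiff {E : Type*} [NormedAddCommGroup E] [NormedSpace ℝ E]
    [CompleteSpace E] {v : E → E} (hv : ContDiff ℝ 1 v) {f g : ℝ → E} {t₀ : ℝ}
    (hf : ∀ t, HasDerivAt f (v (f t)) t) (hg : ∀ t, HasDerivAt g (v (g t)) t)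
    (h : f t₀ = g t₀) : f = g :=
  isMIntegralCurve_Ioo_eq_of_contMDiff_boundaryless (I := 𝓘(ℝ, E)) (v := v)
    (contMDiff_vectorSpace_iff_contDiff.mpr hv) (fun t ↦ (hf t).hasFDerivAt.hasMFDerivAt)
    (fun t ↦ (hg t).hasFDerivAt.hasMFDerivAt) h

lemma eq_of_hasDerivAt_hasDerivAt_of_contDiff {E : Type*} [NormedAddCommGroup E] [NormedSpace ℝ E]
    [CompleteSpace E] {F : E → E} (hF : ContDiff ℝ 1 F) {f f' g g' : ℝ → E} {t₀ : ℝ}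
    (hf : ∀ t, HasDerivAt f (f' t) t) (hf' : ∀ t, HasDerivAt f' (F (f t)) t)
    (hg : ∀ t, HasDerivAt g (g' t) t) (hg' : ∀ t, HasDerivAt g' (F (g t)) t)
    (h : f t₀ = g t₀) (h' : f' t₀ = g' t₀) : f = g := by
  have hprod : (fun t ↦ (f t, f' t)) = fun t ↦ (g t, g' t) :=
    eq_of_hasDerivAt_of_contDiff (v := fun p : E × E ↦ (p.2, F p.1)) (by fun_prop)
      (fun t ↦ (hf t).prodMk (hf' t)) (fun t ↦ (hg t).prodMk (hg' t)) (Prod.ext h h')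
  exact funext fun t ↦ congrArg Prod.fst (congrFun hprod t)

end ODE

section Cubic

lemma vieta_of_three_roots {K : Type*} [Field K] {p q r a b c : K} (hab : a ≠ b) (hac : a ≠ c)
    (hbc : b ≠ c) (ha : a ^ 3 + p * a ^ 2 + q * a + r = 0) (hb : b ^ 3 + p * b ^ 2 + q * b + r = 0)
    (hc : c ^ 3 + p * c ^ 2 + q * c + r = 0) :
    p = -(a + b + c) ∧ q = a * b + a * c + b * c ∧ r = -(a * b * c) := by
  have hquad_ab : a ^ 2 + a * b + b ^ 2 + p * (a + b) + q = 0 :=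
    mul_left_cancel₀ (sub_ne_zero.mpr hab) (by linear_combination ha - hb)
  have hquad_ac : a ^ 2 + a * c + c ^ 2 + p * (a + c) + q = 0 :=
    mul_left_cancel₀ (sub_ne_zero.mpr hac) (by linear_combination ha - hc)
  have hp : p = -(a + b + c) :=
    mul_left_cancel₀ (sub_ne_zero.mpr hbc) (by linear_combination hquad_ab - hquad_ac)
  subst hp
  have hq : q = a * b + a * c + b * c := by linear_combination hquad_ab
  subst hq
  exact ⟨rfl, rfl, by linear_combination ha⟩

lemma exists_strictAnti_cubic_eq_prod {p q r x₀ x₁ x₂ x₃ : ℝ} (h₀₁ : x₀ ≤ x₁) (h₁₂ : x₁ ≤ x₂)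
    (h₂₃ : x₂ ≤ x₃) (h₀ : x₀ ^ 3 + p * x₀ ^ 2 + q * x₀ + r < 0)
    (h₁ : 0 < x₁ ^ 3 + p * x₁ ^ 2 + q * x₁ + r) (h₂ : x₂ ^ 3 + p * x₂ ^ 2 + q * x₂ + r < 0)
    (h₃ : 0 < x₃ ^ 3 + p * x₃ ^ 2 + q * x₃ + r) :
    ∃ D : Fin 3 → ℝ, StrictAnti D ∧
      ∀ x : ℂ, x ^ 3 + p * x ^ 2 + q * x + r = ∏ j, (x - D j) := by
  have hcont : Continuous fun x : ℝ ↦ x ^ 3 + p * x ^ 2 + q * x + r := by fun_prop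
  obtain ⟨c, hc, hc₀⟩ := intermediate_value_Ioo h₀₁ hcont.continuousOn ⟨h₀, h₁⟩
  obtain ⟨b, hb, hb₀⟩ := intermediate_value_Ioo' h₁₂ hcont.continuousOn ⟨h₂, h₁⟩
  obtain ⟨a, ha, ha₀⟩ := intermediate_value_Ioo h₂₃ hcont.continuousOn ⟨h₂, h₃⟩
  have hba : b < a := hb.2.trans ha.1
  have hcb : c < b := hc.2.trans hb.1
  obtain ⟨rfl, rfl, rfl⟩ := vieta_of_three_roots hba.ne' (hcb.trans hba).ne' hcb.ne' ha₀ hb₀ hc₀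
  refine ⟨![a, b, c], Fin.strictAnti_iff_succ_lt.mpr (Fin.forall_fin_two.mpr ⟨hba, hcb⟩),
    fun x ↦ ?_⟩
  simp only [Fin.prod_univ_three, Matrix.cons_val]
  push_cast
  ring

lemma exists_strictAnti_roots_cube_add_mul_sq {β M : ℝ} (hM : 0 < M) (hβM : 27 * M < β ^ 3) :
    ∃ D : Fin 3 → ℝ, StrictAnti D ∧
      ∀ x : ℂ, x ^ 3 + β * x ^ 2 - 4 * M = ∏ j, (x - D j) := by
  have hβ : 0 < β := (Nat.odd_iff.mpr rfl : Odd 3).pow_pos_iff.mp (by linarith)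
  obtain ⟨D, hD, hprod⟩ := exists_strictAnti_cubic_eq_prod (p := β) (q := 0) (r := -(4 * M))
    (x₀ := -β) (x₁ := -(2 / 3) * β) (x₂ := 0) (x₃ := β / 3) (by linarith) (by linarith)
    (by linarith) (by linarith) (by linarith) (by linarith) (by linarith)
  refine ⟨D, hD, fun x ↦ ?_⟩
  rw [← hprod]
  push_cast
  ring

end Cubic

/-- The lattice attached to an equivariant metric: it is rectangular with half periods `ω` and
`I * τ`, and its invariants are those of the Weierstrass equation satisfied by `β / 3 - 2 e^u`. -/
structure IsMetricLattice (L : PeriodPair) (ψ : ℂ) (β ω τ : ℝ) : Prop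
    extends IsRectangular L ω τ where
  g₂_eq : L.g₂ = (4 / 3 * β ^ 2 : ℝ)
  g₃_eq : L.g₃ = (16 * ‖ψ‖ ^ 2 - 8 / 27 * β ^ 3 : ℝ)

lemma exp_neg_two_mul (x : ℝ) : Real.exp (-2 * x) = (Real.exp x ^ 2)⁻¹ := by
  rw [← Real.exp_nat_mul, ← Real.exp_neg]
  norm_num

namespace IsEquivariantMetric

variable {u : ℝ → ℝ} {ψ : ℂ} {β ω τ : ℝ} {L : PeriodPair}

/-- The function `β / 3 - 2 e^u`, which satisfies the differential equation of `℘` and is in fact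
the restriction of `℘` to the horizontal line through the half period `I * τ`. -/
noncomputable def profile (u : ℝ → ℝ) (β : ℝ) (y : ℝ) : ℝ := β / 3 - 2 * Real.exp (u y)

lemma hasDerivAt (h : IsEquivariantMetric u ψ β) (y : ℝ) : HasDerivAt u (deriv u y) y :=
  (h.contDiff.differentiable (by norm_num)).differentiableAt.hasDerivAt

lemma hasDerivAt_deriv (h : IsEquivariantMetric u ψ β) (y : ℝ) :
    HasDerivAt (deriv u) (deriv (deriv u) y) y :=
  (h.contDiff.differentiable_deriv_two y).hasDerivAt

lemma norm_sq_pos (h : IsEquivariantMetric u ψ β) : 0 < ‖ψ‖ ^ 2 := by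
  have := norm_pos_iff.mpr h.hopf_ne_zero
  positivity

lemma exp_mul_deriv_sq (h : IsEquivariantMetric u ψ β) (y : ℝ) :
    (Real.exp (u y) * deriv u y) ^ 2 =
      4 * β * Real.exp (u y) ^ 2 - 8 * Real.exp (u y) ^ 3 - 4 * ‖ψ‖ ^ 2 := by
  have hfirst := h.first_integral y
  rw [exp_neg_two_mul] at hfirst
  field_simp at hfirst
  linear_combination hfirst

lemma hasDerivAt_profile (h : IsEquivariantMetric u ψ β) (y : ℝ) :
    HasDerivAt (profile u β) (-2 * (Real.exp (u y) * deriv u y)) y := by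
  convert! ((h.hasDerivAt y).exp.const_mul 2).const_sub (β / 3) using 1
  ring

lemma hasDerivAt_deriv_profile (h : IsEquivariantMetric u ψ β) (y : ℝ) :
    HasDerivAt (fun y ↦ -2 * (Real.exp (u y) * deriv u y))
      (6 * profile u β y ^ 2 - 2 / 3 * β ^ 2) y := by
  convert! ((h.hasDerivAt y).exp.mul (h.hasDerivAt_deriv y)).const_mul (-2) using 1
  have hfirst := h.first_integral y
  have hgauss := h.gauss y
  rw [exp_neg_two_mul] at hfirst hgauss
  field_simp at hfirst hgauss
  refine mul_right_cancel₀ (Real.exp_ne_zero (u y)) ?_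
  simp only [profile]
  linear_combination 2 * hfirst + 2 * hgauss

lemma root_zero (h : IsEquivariantMetric u ψ β) :
    8 * Real.exp (u 0) ^ 3 - 4 * β * Real.exp (u 0) ^ 2 + 4 * ‖ψ‖ ^ 2 = 0 :=
  h.largest_root.1

lemma three_mul_exp_zero_ne (h : IsEquivariantMetric u ψ β) : 3 * Real.exp (u 0) ≠ β := by
  intro hroot
  refine h.not_constant ⟨u 0, fun y ↦ ?_⟩
  have hstationary : 6 * (-β / 3) ^ 2 - 2 / 3 * β ^ 2 = 0 := by ring
  have hconst : profile u β = fun _ ↦ -β / 3 :=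
    eq_of_hasDerivAt_hasDerivAt_of_contDiff (F := fun x ↦ 6 * x ^ 2 - 2 / 3 * β ^ 2) (g' := 0)
      (t₀ := 0) (by fun_prop) h.hasDerivAt_profile h.hasDerivAt_deriv_profile
      (fun x ↦ hasDerivAt_const x _) (fun x ↦ by simp [hstationary])
      (by rw [profile]; linear_combination (-2 / 3) * hroot) (by simp [h.deriv_zero])
  have hy : profile u β y = -β / 3 := congrFun hconst y
  rw [profile] at hy
  exact Real.exp_injective (by linear_combination (-1 / 2) * hy - hroot / 3)

lemma lt_beta_cube (h : IsEquivariantMetric u ψ β) : 27 * ‖ψ‖ ^ 2 < β ^ 3 := by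
  have hroot := h.root_zero
  have hψ := h.norm_sq_pos
  have hβ : 0 < β := by
    refine pos_of_mul_pos_left (b := 4 * Real.exp (u 0) ^ 2) ?_ (by positivity)
    have : 0 < Real.exp (u 0) ^ 3 := by positivity
    linarith
  have hne : β - 3 * Real.exp (u 0) ≠ 0 := sub_ne_zero.mpr h.three_mul_exp_zero_ne.symm
  have hpos : 0 < (β - 3 * Real.exp (u 0)) ^ 2 * (β + 6 * Real.exp (u 0)) := by positivity
  linarith

lemma exists_hasRealRoots (h : IsEquivariantMetric u ψ β) (hL : IsMetricLattice L ψ β ω τ) :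
    ∃ e₁ e₂ : ℝ, HasRealRoots L e₁ e₂ (profile u β 0) := by
  obtain ⟨D, hD, hprod⟩ := exists_strictAnti_roots_cube_add_mul_sq h.norm_sq_pos h.lt_beta_cube
  simp only [Fin.prod_univ_three] at hprod
  have hD₁₂ : D 2 < D 1 := hD (by decide)
  have hD₀₁ : D 1 < D 0 := hD (by decide)
  have hmin : D 2 = -(2 * Real.exp (u 0)) := by
    refine le_antisymm ?_ ?_
    · have hroot : (-(2 * Real.exp (u 0)) - D 0) * (-(2 * Real.exp (u 0)) - D 1) *
          (-(2 * Real.exp (u 0)) - D 2) = 0 := by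
        have := hprod (-(2 * Real.exp (u 0)) : ℝ)
        norm_cast at this
        linear_combination -this - h.root_zero
      rcases mul_eq_zero.mp hroot with hroot | hroot
      · rcases mul_eq_zero.mp hroot with hroot | hroot <;> linarith
      · linarith
    · have hroot := hprod (D 2)
      norm_cast at hroot
      have : -D 2 / 2 ≤ Real.exp (u 0) := h.largest_root.2 (by
        rw [mem_ofPred_eq]; linear_combination -hroot)
      linarith
  refine ⟨β / 3 + D 0, β / 3 + D 1, fun x ↦ ?_, by linarith, by rw [profile]; linarith⟩
  have hx := hprod (x - β / 3)
  rw [hL.g₂_eq, hL.g₃_eq, profile, show β / 3 - 2 * Real.exp (u 0) = β / 3 + D 2 by linarith]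
  push_cast at hx ⊢
  linear_combination 4 * hx

lemma weierstrassP_I_mul_τ_add (h : IsEquivariantMetric u ψ β) (hL : IsMetricLattice L ψ β ω τ)
    (y : ℝ) : L.weierstrassP (I * τ + y) = profile u β y := by
  obtain ⟨e₁, e₂, he⟩ := h.exists_hasRealRoots hL
  have hreal (t : ℝ) : L.weierstrassP (I * τ + t) = (L.weierstrassP (I * τ + t)).re :=
    Complex.ext rfl (by simpa using hL.weierstrassP_I_mul_τ_add_im t)
  have hP (t : ℝ) : HasDerivAt (fun t : ℝ ↦ (L.weierstrassP (I * τ + t)).re)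
      (L.derivWeierstrassP (I * τ + t)).re t :=
    reCLM.hasFDerivAt.comp_hasDerivAt t
      ((hasDerivAt_weierstrassP L (hL.I_mul_τ_add_notMem t)).comp_const_add _ _).comp_ofReal
  have hP' (t : ℝ) : HasDerivAt (fun t : ℝ ↦ (L.derivWeierstrassP (I * τ + t)).re)
      (6 * (L.weierstrassP (I * τ + t)).re ^ 2 - 2 / 3 * β ^ 2) t := by
    convert! reCLM.hasFDerivAt.comp_hasDerivAt t ((hasDerivAt_derivWeierstrassP L
      (hL.I_mul_τ_add_notMem t)).comp_const_add _ _).comp_ofReal using 1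
    rw [reCLM_apply, hreal t, hL.g₂_eq, ofReal_re]
    norm_cast
    ring
  have heq : (fun t : ℝ ↦ (L.weierstrassP (I * τ + t)).re) = profile u β :=
    eq_of_hasDerivAt_hasDerivAt_of_contDiff (F := fun x ↦ 6 * x ^ 2 - 2 / 3 * β ^ 2) (t₀ := 0)
      (by fun_prop) hP hP' h.hasDerivAt_profile h.hasDerivAt_deriv_profile
      (by simp [he.weierstrassP_I_mul_τ hL.toIsRectangular])
      (by simp [h.deriv_zero, derivWeierstrassP_eq_zero_of_two_mul_mem L hL.two_mul_I_mul_τ_mem])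
  rw [hreal y]
  exact_mod_cast congrFun heq y

end IsEquivariantMetric

section HopfCoeff

variable {u : ℝ → ℝ} {ψ lam : ℂ} {s : ℝ}

lemma conj_hopfCoeff (hlam : ‖lam‖ = 1) : conj (hopfCoeff ψ lam) = lam ^ 3 * conj ψ := by
  rw [hopfCoeff, map_mul, map_inv₀, map_pow, ← inv_eq_conj hlam, inv_pow, inv_inv]

lemma hopfCoeff_re_sq_add_im_sq (hlam : ‖lam‖ = 1) :
    (hopfCoeff ψ lam).re ^ 2 + (hopfCoeff ψ lam).im ^ 2 = ‖ψ‖ ^ 2 := by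
  have hnorm : ‖hopfCoeff ψ lam‖ = ‖ψ‖ := by simp [hopfCoeff, hlam]
  rw [← hnorm, ← normSq_eq_norm_sq, normSq_apply]
  ring

lemma betaDenom_eq (hlam : ‖lam‖ = 1) (u : ℝ → ℝ) (s : ℝ) :
    betaDenom u ψ lam s = -2 * I * (hopfCoeff ψ lam).im - (Real.exp (u s) * deriv u s : ℝ) := by
  have hsub := sub_conj (hopfCoeff ψ lam)
  push_cast at hsub
  rw [betaDenom, ← conj_hopfCoeff hlam]
  linear_combination -hsub

lemma betaDenom_eq_zero_iff (hlam : ‖lam‖ = 1) :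
    betaDenom u ψ lam s = 0 ↔ (hopfCoeff ψ lam).im = 0 ∧ Real.exp (u s) * deriv u s = 0 := by
  rw [betaDenom_eq hlam]
  generalize Real.exp (u s) * deriv u s = w
  simp [Complex.ext_iff, and_comm]

lemma betaDenom_ne_zero (hlam : ‖lam‖ = 1) (him : (hopfCoeff ψ lam).im ≠ 0) (s : ℝ) :
    betaDenom u ψ lam s ≠ 0 :=
  fun hzero ↦ him ((betaDenom_eq_zero_iff hlam).mp hzero).1

lemma betaOneIntegrand_eq (hlam : ‖lam‖ = 1) (h : betaDenom u ψ lam s ≠ 0) :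
    betaOneIntegrand u ψ lam s = I + 2 * I * (hopfCoeff ψ lam).re / betaDenom u ψ lam s := by
  have hre := add_conj (hopfCoeff ψ lam)
  rw [conj_hopfCoeff hlam] at hre
  rw [betaOneIntegrand, div_eq_iff h, add_mul, div_mul_cancel₀ _ h, betaDenom]
  push_cast at hre ⊢
  linear_combination I * hre

lemma charpoly_potentialMatrix (hlam : ‖lam‖ = 1) :
    (potentialMatrix u ψ lam).charpoly = .X ^ 3 +
      .C ((2 * Real.exp (u 0) + ‖ψ‖ ^ 2 * Real.exp (-2 * u 0) : ℝ) : ℂ) * .X -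
      .C (2 * I * (hopfCoeff ψ lam).re) := by
  refine Polynomial.funext fun x ↦ ?_
  have hlam₀ : lam ≠ 0 := norm_ne_zero_iff.mp (hlam.symm ▸ one_ne_zero)
  have hnorm : ψ * conj ψ = (‖ψ‖ : ℂ) ^ 2 := mul_conj' ψ
  have hre : (2 * (hopfCoeff ψ lam).re : ℂ) = (lam ^ 3)⁻¹ * ψ + lam ^ 3 * conj ψ := by
    rw [← hopfCoeff, ← conj_hopfCoeff hlam, add_conj, ofReal_mul, ofReal_ofNat]
  have hexp : Real.exp (u 0) = Real.exp (u 0 / 2) ^ 2 := by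
    rw [← Real.exp_nat_mul]
    congr 1
    push_cast
    ring
  rw [Matrix.eval_charpoly, Matrix.det_fin_three]
  simp only [potentialMatrix, Matrix.sub_apply, Matrix.scalar_apply, Matrix.diagonal_apply,
    Matrix.of_apply, Matrix.cons_val', Matrix.cons_val, Fin.isValue, Polynomial.eval_add,
    Polynomial.eval_sub, Polynomial.eval_mul, Polynomial.eval_pow, Polynomial.eval_X,
    Polynomial.eval_C, Fin.reduceEq, if_true, if_false]
  rw [mul_right_comm 2 I, hre, exp_neg_two_mul, Real.exp_neg, hexp]
  push_cast
  rw [← hnorm]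
  have hv : (Real.exp (u 0 / 2) : ℂ) ≠ 0 := by exact_mod_cast Real.exp_ne_zero _
  push_cast at hv
  generalize Complex.exp ((u 0 : ℂ) / 2) = a at hv ⊢
  field_simp
  ring_nf
  simp only [I_sq, I_pow_three]
  ring

end HopfCoeff

lemma linear_div_prod_sub_eq_sum {e : Fin 3 → ℝ} (he : Function.Injective e) {x : ℝ}
    (hx : ∀ j, x ≠ e j) (m n : ℝ) :
    (m + n * x) / ∏ j, (x - e j) = ∑ j, (m + n * e j) / rootProduct e j * (x - e j)⁻¹ := by
  have h₀₁ : e 0 - e 1 ≠ 0 := sub_ne_zero.mpr (he.ne (by decide))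
  have h₀₂ : e 0 - e 2 ≠ 0 := sub_ne_zero.mpr (he.ne (by decide))
  have h₁₂ : e 1 - e 2 ≠ 0 := sub_ne_zero.mpr (he.ne (by decide))
  have hx₀ := sub_ne_zero.mpr (hx 0)
  have hx₁ := sub_ne_zero.mpr (hx 1)
  have hx₂ := sub_ne_zero.mpr (hx 2)
  have hr₀ : rootProduct e 0 = (e 0 - e 1) * (e 0 - e 2) := rfl
  have hr₁ : rootProduct e 1 = -((e 0 - e 1) * (e 1 - e 2)) := by
    change (e 1 - e 2) * (e 1 - e 0) = _
    ring
  have hr₂ : rootProduct e 2 = (e 0 - e 2) * (e 1 - e 2) := by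
    change (e 2 - e 0) * (e 2 - e 1) = _
    ring
  rw [Fin.prod_univ_three, Fin.sum_univ_three, hr₀, hr₁, hr₂]
  field_simp
  ring

/-- The roots `ẽ_j` of the shifted Weierstrass cubic `4 x³ - g₂ x - (g₃ - 16 Im(λ⁻³ψ)²)`, in
decreasing order. -/
structure IsShiftedRoots (ψ lam : ℂ) (β : ℝ) (e : Fin 3 → ℝ) : Prop where
  strictAnti : StrictAnti e
  cubic : ∀ x : ℂ, 4 * x ^ 3 - (4 / 3 * β ^ 2 : ℝ) * x -
    (16 * ‖ψ‖ ^ 2 - 8 / 27 * β ^ 3 - 16 * (hopfCoeff ψ lam).im ^ 2 : ℝ) = 4 * ∏ j, (x - e j)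

namespace IsShiftedRoots

variable {ψ lam : ℂ} {β : ℝ} {e : Fin 3 → ℝ}

/-- The number `d_j` for which `i d_j` is an eigenvalue of `D(λ)`. As `ẽ_j - β/3 = d_k d_l` and
`d_0 d_1 d_2 = -2 Re(λ⁻³ψ)`, it can be recovered from `ẽ_j`. -/
noncomputable def eigenvalue (ψ lam : ℂ) (β : ℝ) (e : Fin 3 → ℝ) (j : Fin 3) : ℝ :=
  -2 * (hopfCoeff ψ lam).re / (e j - β / 3)

lemma prod_sub (he : IsShiftedRoots ψ lam β e) (x : ℝ) :
    4 * ∏ j, (x - e j) = 4 * x ^ 3 - 4 / 3 * β ^ 2 * x -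
      (16 * ‖ψ‖ ^ 2 - 8 / 27 * β ^ 3 - 16 * (hopfCoeff ψ lam).im ^ 2) := by
  exact_mod_cast (he.cubic x).symm

lemma cubic_self (he : IsShiftedRoots ψ lam β e) (j : Fin 3) :
    4 * e j ^ 3 - 4 / 3 * β ^ 2 * e j - (16 * ‖ψ‖ ^ 2 - 8 / 27 * β ^ 3) =
      -16 * (hopfCoeff ψ lam).im ^ 2 := by
  have hroot := he.prod_sub (e j)
  rw [Finset.prod_eq_zero (Finset.mem_univ j) (sub_self _)] at hroot
  linear_combination -hroot

lemma vieta (he : IsShiftedRoots ψ lam β e) (hlam : ‖lam‖ = 1) :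
    (e 0 - β / 3) + (e 1 - β / 3) + (e 2 - β / 3) = -β ∧
    (e 0 - β / 3) * (e 1 - β / 3) + (e 0 - β / 3) * (e 2 - β / 3) +
      (e 1 - β / 3) * (e 2 - β / 3) = 0 ∧
    (e 0 - β / 3) * (e 1 - β / 3) * (e 2 - β / 3) = 4 * (hopfCoeff ψ lam).re ^ 2 := by
  have hnorm := hopfCoeff_re_sq_add_im_sq (ψ := ψ) hlam
  have hzero := he.prod_sub (β / 3)
  have hone := he.prod_sub (β / 3 + 1)
  have hneg_one := he.prod_sub (β / 3 - 1)
  simp only [Fin.prod_univ_three] at hzero hone hneg_one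
  refine ⟨?_, ?_, ?_⟩
  · linear_combination (2 * hzero - hone - hneg_one) / 8
  · linear_combination (hone - hneg_one) / 8
  · linear_combination -hzero / 4 - 4 * hnorm

section Eigenvalue

variable (he : IsShiftedRoots ψ lam β e) (hlam : ‖lam‖ = 1) (hre : (hopfCoeff ψ lam).re ≠ 0)
include he hlam hre

lemma sub_beta_div_three_ne_zero (j : Fin 3) : e j - β / 3 ≠ 0 := by
  obtain ⟨-, -, hprod⟩ := he.vieta hlam
  have hne : (e 0 - β / 3) * (e 1 - β / 3) * (e 2 - β / 3) ≠ 0 := by rw [hprod]; positivity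
  simp only [mul_ne_zero_iff] at hne
  fin_cases j
  exacts [hne.1.1, hne.1.2, hne.2]

lemma eigenvalue_mul (j : Fin 3) :
    eigenvalue ψ lam β e j * (e j - β / 3) = -2 * (hopfCoeff ψ lam).re :=
  div_mul_cancel₀ _ (he.sub_beta_div_three_ne_zero hlam hre j)

lemma eigenvalue_ne_zero (j : Fin 3) : eigenvalue ψ lam β e j ≠ 0 :=
  div_ne_zero (by simpa using hre) (he.sub_beta_div_three_ne_zero hlam hre j)

lemma eq_eigenvalue_mul (j : Fin 3) :
    e j = β / 3 + eigenvalue ψ lam β e (j + 1) * eigenvalue ψ lam β e (j + 2) := by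
  obtain ⟨-, -, hprod⟩ := he.vieta hlam
  have hcyclic : (e j - β / 3) * ((e (j + 1) - β / 3) * (e (j + 2) - β / 3)) =
      4 * (hopfCoeff ψ lam).re ^ 2 := by
    rw [← hprod]
    fin_cases j <;> simp only [Fin.reduceFinMk, Fin.reduceAdd, Fin.isValue] <;> ring
  have h₁ := he.sub_beta_div_three_ne_zero hlam hre (j + 1)
  have h₂ := he.sub_beta_div_three_ne_zero hlam hre (j + 2)
  rw [← sub_eq_iff_eq_add', eigenvalue, eigenvalue, div_mul_div_comm,
    eq_div_iff (mul_ne_zero h₁ h₂), hcyclic]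
  ring

lemma eigenvalue_vieta :
    eigenvalue ψ lam β e 0 + eigenvalue ψ lam β e 1 + eigenvalue ψ lam β e 2 = 0 ∧
    eigenvalue ψ lam β e 0 * eigenvalue ψ lam β e 1 +
      eigenvalue ψ lam β e 0 * eigenvalue ψ lam β e 2 +
      eigenvalue ψ lam β e 1 * eigenvalue ψ lam β e 2 = -β ∧
    eigenvalue ψ lam β e 0 * eigenvalue ψ lam β e 1 * eigenvalue ψ lam β e 2 =
      -2 * (hopfCoeff ψ lam).re := by
  obtain ⟨hsum, hpairs, -⟩ := he.vieta hlam
  have h₀ : e 0 = β / 3 + _ * _ := he.eq_eigenvalue_mul hlam hre 0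
  have h₁ : e 1 = β / 3 + _ * _ := he.eq_eigenvalue_mul hlam hre 1
  have h₂ : e 2 = β / 3 + _ * _ := he.eq_eigenvalue_mul hlam hre 2
  simp only [Fin.reduceAdd, Fin.isValue] at h₀ h₁ h₂
  have hmul := he.eigenvalue_mul hlam hre 0
  have hprod : eigenvalue ψ lam β e 0 * eigenvalue ψ lam β e 1 * eigenvalue ψ lam β e 2 =
      -2 * (hopfCoeff ψ lam).re := by linear_combination hmul - eigenvalue ψ lam β e 0 * h₀
  refine ⟨?_, by linear_combination hsum - h₀ - h₁ - h₂, hprod⟩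
  refine mul_left_cancel₀ (mul_ne_zero (by norm_num : (-2 : ℝ) ≠ 0) hre) ?_
  rw [h₀, h₁, h₂] at hpairs
  linear_combination hpairs - (eigenvalue ψ lam β e 0 + eigenvalue ψ lam β e 1 +
    eigenvalue ψ lam β e 2) * hprod

end Eigenvalue

end IsShiftedRoots

namespace IsEquivariantMetric

variable {u : ℝ → ℝ} {ψ lam : ℂ} {β : ℝ} {e : Fin 3 → ℝ}

lemma exists_isShiftedRoots (h : IsEquivariantMetric u ψ β) (hlam : ‖lam‖ = 1)
    (hre : (hopfCoeff ψ lam).re ≠ 0) : ∃ e, IsShiftedRoots ψ lam β e := by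
  have hnorm := hopfCoeff_re_sq_add_im_sq (ψ := ψ) hlam
  obtain ⟨D, hD, hprod⟩ := exists_strictAnti_roots_cube_add_mul_sq (β := β)
    (M := (hopfCoeff ψ lam).re ^ 2) (by positivity)
    (by linarith [h.lt_beta_cube, sq_nonneg (hopfCoeff ψ lam).im])
  refine ⟨fun j ↦ β / 3 + D j, hD.const_add _, fun x ↦ ?_⟩
  simp only [ofReal_add, ← sub_sub]
  rw [← hprod, ← hnorm]
  push_cast
  ring

lemma charpoly_potentialMatrix_eq_prod (h : IsEquivariantMetric u ψ β)
    (he : IsShiftedRoots ψ lam β e) (hlam : ‖lam‖ = 1) (hre : (hopfCoeff ψ lam).re ≠ 0) :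
    (potentialMatrix u ψ lam).charpoly =
      ∏ j, (.X - .C (I * (IsShiftedRoots.eigenvalue ψ lam β e j : ℂ))) := by
  obtain ⟨hsum, hpairs, hprod⟩ := he.eigenvalue_vieta hlam hre
  have hβ : 2 * Real.exp (u 0) + ‖ψ‖ ^ 2 * Real.exp (-2 * u 0) = β := by
    simpa [h.deriv_zero] using h.first_integral 0
  rw [charpoly_potentialMatrix hlam, hβ]
  refine Polynomial.funext fun x ↦ ?_
  simp only [Polynomial.eval_add, Polynomial.eval_sub, Polynomial.eval_mul, Polynomial.eval_pow,
    Polynomial.eval_X, Polynomial.eval_C, Fin.prod_univ_three]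
  generalize IsShiftedRoots.eigenvalue ψ lam β e = d at *
  have hsum' : (d 0 + d 1 + d 2 : ℂ) = 0 := by exact_mod_cast hsum
  have hpairs' : (d 0 * d 1 + d 0 * d 2 + d 1 * d 2 : ℂ) = -β := by exact_mod_cast hpairs
  have hprod' : (d 0 * d 1 * d 2 : ℂ) = -2 * (hopfCoeff ψ lam).re := by exact_mod_cast hprod
  linear_combination I * x ^ 2 * hsum' + x * hpairs' - I * hprod' -
    (x * (d 0 * d 1 + d 0 * d 2 + d 1 * d 2) - I * (d 0 * d 1 * d 2)) * I_sq

end IsEquivariantMetric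

section Reflection

lemma setIntegral_eq_of_reflect_add {f g : ℝ → ℂ} {A : Set ℝ} {c : ℝ} (hA : MeasurableSet A)
    (hAc : ∀ s ∈ A, c - s ∈ A) (hf : IntegrableOn f A)
    (hfg : ∀ s ∈ A, f s + f (c - s) = 2 * g s) : ∫ s in A, f s = ∫ s in A, g s := by
  have hpre : (c - ·) ⁻¹' A = A := by
    ext s
    exact ⟨fun hs ↦ by simpa using hAc _ hs, hAc s⟩
  have hpres := Measure.measurePreserving_sub_left volume c
  have hemb := (MeasurableEquiv.subLeft c).measurableEmbedding
  have hreflect : ∫ s in A, f (c - s) = ∫ s in A, f s := by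
    simpa only [hpre] using hpres.setIntegral_preimage_emb hemb f A
  have hint : IntegrableOn (fun s ↦ f (c - s)) A := by
    simpa only [hpre, Function.comp_def] using
      (hpres.integrableOn_comp_preimage hemb (s := A)).mpr hf
  refine mul_left_cancel₀ (two_ne_zero' ℂ) ?_
  calc 2 * ∫ s in A, f s = (∫ s in A, f s) + ∫ s in A, f (c - s) := by rw [hreflect, two_mul]
    _ = ∫ s in A, 2 * g s := by rw [← integral_add hf hint, setIntegral_congr_fun hA hfg]
    _ = 2 * ∫ s in A, g s := integral_const_mul _ _

lemma intervalIntegral_eq_of_reflect_add {f g : ℝ → ℂ} {a b : ℝ} (hab : a ≤ b)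
    (hf : IntervalIntegrable f volume a b) (hfg : ∀ s, f s + f (a + b - s) = 2 * g s) :
    ∫ s in a..b, f s = ∫ s in a..b, g s := by
  simp only [intervalIntegral.integral_of_le hab, ← integral_Icc_eq_integral_Ioc]
  exact setIntegral_eq_of_reflect_add (c := a + b) measurableSet_Icc
    (fun s hs ↦ ⟨by linarith [hs.2], by linarith [hs.1]⟩)
    ((intervalIntegrable_iff_integrableOn_Icc_of_le hab).mp hf) fun s _ ↦ hfg s

lemma sub_mem_thickening {S : Set ℝ} {c : ℝ} (hS : ∀ s ∈ S, c - s ∈ S) {ε s : ℝ}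
    (hs : s ∈ Metric.thickening ε S) : c - s ∈ Metric.thickening ε S := by
  obtain ⟨z, hz, hdist⟩ := Metric.mem_thickening_iff.mp hs
  exact Metric.mem_thickening_iff.mpr ⟨c - z, hS z hz, by rwa [dist_sub_left]⟩

lemma tendsto_volume_Icc_diff_thickening {a b : ℝ} (hab : a ≤ b) {S : Set ℝ} (hS : S.Finite) :
    Tendsto (fun ε ↦ volume.real (Icc a b \ Metric.thickening ε S)) (𝓝[>] 0) (𝓝 (b - a)) := by
  have hfinite (ε : ℝ) : volume (Metric.thickening ε S) ≠ ⊤ :=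
    hS.isBounded.thickening.measure_lt_top.ne
  have hthickening : Tendsto (fun ε ↦ volume.real (Metric.thickening ε S)) (𝓝[>] 0) (𝓝 0) := by
    have htendsto := tendsto_measure_thickening_of_isClosed (μ := volume)
      ⟨1, one_pos, hfinite 1⟩ hS.isClosed
    rw [hS.measure_zero] at htendsto
    exact (ENNReal.tendsto_toReal ENNReal.zero_ne_top).comp htendsto
  have hIcc : volume.real (Icc a b) = b - a := by simp [measureReal_def, hab]
  rw [← hIcc]
  refine tendsto_of_tendsto_of_tendsto_of_le_of_le
    (by simpa using hthickening.const_sub (volume.real (Icc a b))) tendsto_const_nhds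
    (fun ε ↦ le_measureReal_sdiff (h := hfinite ε))
    fun ε ↦ measureReal_mono sdiff_subset (by simp)

lemma HasPrincipalValue.of_reflect_add {f : ℝ → ℂ} {a b : ℝ} {S : Set ℝ} {c : ℂ} (hab : a ≤ b)
    (hS : S.Finite) (hSab : ∀ s ∈ S, a + b - s ∈ S) (hf : ContinuousOn f (Icc a b \ S))
    (hfc : ∀ s ∈ Icc a b \ S, f s + f (a + b - s) = 2 * c) :
    HasPrincipalValue f a b S ((b - a) * c) := by
  have hsubset {ε : ℝ} (hε : 0 < ε) : Icc a b \ Metric.thickening ε S ⊆ Icc a b \ S :=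
    sdiff_subset_sdiff_right (Metric.self_subset_thickening hε S)
  have hcompact (ε : ℝ) : IsCompact (Icc a b \ Metric.thickening ε S) :=
    isCompact_Icc.diff Metric.isOpen_thickening
  have hint {ε : ℝ} (hε : 0 < ε) : IntegrableOn f (Icc a b \ Metric.thickening ε S) :=
    (hf.mono (hsubset hε)).integrableOn_compact (hcompact ε)
  have hvalue {ε : ℝ} (hε : 0 < ε) : ∫ s in Icc a b \ Metric.thickening ε S, f s =
      (volume.real (Icc a b \ Metric.thickening ε S) : ℂ) * c := by
    rw [setIntegral_eq_of_reflect_add (c := a + b) (hcompact ε).measurableSet ?_ (hint hε)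
      fun s hs ↦ hfc s (hsubset hε hs), setIntegral_const, real_smul]
    exact fun s hs ↦ ⟨⟨by linarith [hs.1.2], by linarith [hs.1.1]⟩,
      fun hs' ↦ hs.2 (by simpa using sub_mem_thickening hSab hs')⟩
  refine ⟨fun ε hε ↦ hint hε, ?_⟩
  have hvolume := (continuous_ofReal.tendsto _).comp (tendsto_volume_Icc_diff_thickening hab hS)
  rw [ofReal_sub] at hvolume
  refine (hvolume.mul_const c).congr' ?_
  filter_upwards [self_mem_nhdsWithin] with ε hε
  exact (hvalue hε).symm

end Reflection

namespace IsEquivariantMetric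

variable {u : ℝ → ℝ} {ψ lam : ℂ} {β ω τ : ℝ} {L : PeriodPair}

section Continuity

lemma continuous_profile (h : IsEquivariantMetric u ψ β) : Continuous (profile u β) :=
  continuous_iff_continuousAt.mpr fun y ↦ (h.hasDerivAt_profile y).continuousAt

lemma continuous_exp (h : IsEquivariantMetric u ψ β) : Continuous fun s ↦ Real.exp (u s) :=
  h.contDiff.continuous.rexp

lemma continuous_deriv (h : IsEquivariantMetric u ψ β) : Continuous (deriv u) :=
  h.contDiff.continuous_deriv (by norm_num)

lemma continuous_betaDenom (h : IsEquivariantMetric u ψ β) : Continuous (betaDenom u ψ lam) :=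
  continuous_const.sub (continuous_ofReal.comp (h.continuous_exp.mul h.continuous_deriv))

lemma continuousOn_betaOneIntegrand (h : IsEquivariantMetric u ψ β) :
    ContinuousOn (betaOneIntegrand u ψ lam) {s | betaDenom u ψ lam s ≠ 0} :=
  ContinuousOn.div (continuous_const.sub (continuous_const.mul (continuous_ofReal.comp
    (h.continuous_deriv.mul h.continuous_exp)))).continuousOn
    h.continuous_betaDenom.continuousOn fun _ hs ↦ hs

lemma continuousOn_betaTwoIntegrand (h : IsEquivariantMetric u ψ β) :
    ContinuousOn (betaTwoIntegrand u ψ lam) {s | betaDenom u ψ lam s ≠ 0} :=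
  ContinuousOn.div (continuous_ofReal.comp (continuous_const.mul h.continuous_exp)).continuousOn
    h.continuous_betaDenom.continuousOn fun _ hs ↦ hs

lemma continuous_betaOneIntegrand (h : IsEquivariantMetric u ψ β) (hlam : ‖lam‖ = 1)
    (him : (hopfCoeff ψ lam).im ≠ 0) : Continuous (betaOneIntegrand u ψ lam) :=
  continuousOn_univ.mp <| h.continuousOn_betaOneIntegrand.mono
    fun s _ ↦ betaDenom_ne_zero hlam him s

lemma continuous_betaTwoIntegrand (h : IsEquivariantMetric u ψ β) (hlam : ‖lam‖ = 1)
    (him : (hopfCoeff ψ lam).im ≠ 0) : Continuous (betaTwoIntegrand u ψ lam) :=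
  continuousOn_univ.mp <| h.continuousOn_betaTwoIntegrand.mono
    fun s _ ↦ betaDenom_ne_zero hlam him s

lemma continuous_linear_div_betaDenom (h : IsEquivariantMetric u ψ β) (hlam : ‖lam‖ = 1)
    (him : (hopfCoeff ψ lam).im ≠ 0) (m n : ℝ) :
    Continuous fun s ↦ ((m + n * profile u β s : ℝ) : ℂ) / betaDenom u ψ lam s :=
  (continuous_ofReal.comp (continuous_const.add (continuous_const.mul h.continuous_profile))).div
    h.continuous_betaDenom (betaDenom_ne_zero hlam him)

end Continuity

section Period

variable (h : IsEquivariantMetric u ψ β) (hL : IsMetricLattice L ψ β ω τ)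
include h hL

lemma profile_two_mul_ω_sub (s : ℝ) : profile u β (2 * ω - s) = profile u β s := by
  have hperiod : 2 * (ω : ℂ) + 2 * (I * τ) ∈ L.lattice :=
    add_mem hL.two_mul_ω_mem hL.two_mul_I_mul_τ_mem
  have harg : I * τ + ((2 * ω - s : ℝ) : ℂ) = -(I * τ + s) + (2 * ω + 2 * (I * τ)) := by
    push_cast
    ring
  have hP := L.weierstrassP_add_coe (-(I * τ + s)) ⟨_, hperiod⟩
  rw [← harg, L.weierstrassP_neg, h.weierstrassP_I_mul_τ_add hL,
    h.weierstrassP_I_mul_τ_add hL] at hP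
  exact_mod_cast hP

lemma exp_two_mul_ω_sub (s : ℝ) : Real.exp (u (2 * ω - s)) = Real.exp (u s) := by
  have hprofile := h.profile_two_mul_ω_sub hL s
  rw [profile, profile] at hprofile
  linarith

lemma exp_mul_deriv_two_mul_ω_sub (s : ℝ) :
    Real.exp (u (2 * ω - s)) * deriv u (2 * ω - s) = -(Real.exp (u s) * deriv u s) := by
  have hderiv := (h.hasDerivAt_profile (2 * ω - s)).comp_const_sub (2 * ω) s
  simp only [h.profile_two_mul_ω_sub hL] at hderiv
  linarith [hderiv.unique (h.hasDerivAt_profile s)]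

lemma betaDenom_add_two_mul_ω_sub (hlam : ‖lam‖ = 1) (s : ℝ) :
    betaDenom u ψ lam s + betaDenom u ψ lam (2 * ω - s) = -4 * I * (hopfCoeff ψ lam).im := by
  rw [betaDenom_eq hlam, betaDenom_eq hlam, h.exp_mul_deriv_two_mul_ω_sub hL, ofReal_neg]
  ring

lemma betaDenom_mul_two_mul_ω_sub (hlam : ‖lam‖ = 1) (s : ℝ) :
    betaDenom u ψ lam s * betaDenom u ψ lam (2 * ω - s) =
      (-((Real.exp (u s) * deriv u s) ^ 2 + 4 * (hopfCoeff ψ lam).im ^ 2) : ℝ) := by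
  rw [betaDenom_eq hlam, betaDenom_eq hlam, h.exp_mul_deriv_two_mul_ω_sub hL]
  generalize Real.exp (u s) * deriv u s = w
  push_cast
  linear_combination 4 * (hopfCoeff ψ lam).im ^ 2 * I_sq

lemma betaDenom_two_mul_ω_sub (hlam : ‖lam‖ = 1) (him : (hopfCoeff ψ lam).im = 0) (s : ℝ) :
    betaDenom u ψ lam (2 * ω - s) = -betaDenom u ψ lam s := by
  have hadd := h.betaDenom_add_two_mul_ω_sub hL hlam s
  rw [him, ofReal_zero, mul_zero] at hadd
  exact eq_neg_of_add_eq_zero_right hadd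

lemma derivWeierstrassP_I_mul_τ_add (s : ℝ) :
    L.derivWeierstrassP (I * τ + s) = (-2 * (Real.exp (u s) * deriv u s) : ℝ) := by
  have hderiv : HasDerivAt (fun t : ℝ ↦ L.weierstrassP (I * τ + t))
      (L.derivWeierstrassP (I * τ + s)) s :=
    ((hasDerivAt_weierstrassP L (hL.I_mul_τ_add_notMem s)).comp_const_add _ _).comp_ofReal
  simp only [h.weierstrassP_I_mul_τ_add hL] at hderiv
  exact hderiv.unique (h.hasDerivAt_profile s).ofReal_comp

lemma finite_zeros_exp_mul_deriv (a b : ℝ) :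
    {s | s ∈ Icc a b ∧ Real.exp (u s) * deriv u s = 0}.Finite := by
  refine IsCompact.finite (isCompact_Icc.inter_right
    (isClosed_eq (h.continuous_exp.mul h.continuous_deriv) continuous_const)) ?_
  rw [isDiscrete_iff_nhdsNE]
  intro s _
  have hline : Tendsto (fun t : ℝ ↦ I * τ + t) (𝓝[≠] s) (𝓝[≠] (I * τ + s)) := by
    refine (Continuous.continuousAt (by fun_prop)).continuousWithinAt.tendsto_nhdsWithin ?_
    intro t ht
    simpa using ht
  rw [← disjoint_iff, disjoint_principal_right]
  filter_upwards [hline.eventually (eventually_derivWeierstrassP_ne_zero L _)] with t ht hzero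
  exact ht (by rw [h.derivWeierstrassP_I_mul_τ_add hL, hzero.2, mul_zero, ofReal_zero])

lemma integral_inv_profile_sub {α : ℂ} {x : ℝ} (hα : |α.im| < τ)
    (hα' : L.derivWeierstrassP α ≠ 0) (hx : L.weierstrassP α = x) :
    ((∫ s in (0 : ℝ)..(2 * ω), (profile u β s - x)⁻¹ : ℝ) : ℂ) = zetaTerm L ω α := by
  rw [← hL.integral_inv_weierstrassP_sub hα hα', ← intervalIntegral.integral_ofReal]
  simp only [h.weierstrassP_I_mul_τ_add hL, hx, ofReal_inv, ofReal_sub]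

end Period

section PrincipalValue

variable (h : IsEquivariantMetric u ψ β) (hL : IsMetricLattice L ψ β ω τ) (hlam : ‖lam‖ = 1)
  (him : (hopfCoeff ψ lam).im = 0)
include h hL hlam him

lemma hasPrincipalValue_of_reflect_add {f : ℝ → ℂ} {c : ℂ}
    (hf : ContinuousOn f {s | betaDenom u ψ lam s ≠ 0})
    (hfc : ∀ s, betaDenom u ψ lam s ≠ 0 → f s + f (2 * ω - s) = 2 * c) :
    HasPrincipalValue f 0 (2 * ω) {s | s ∈ Icc 0 (2 * ω) ∧ betaDenom u ψ lam s = 0}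
      (2 * ω * c) := by
  set S := {s | s ∈ Icc 0 (2 * ω) ∧ betaDenom u ψ lam s = 0}
  have hne {s : ℝ} (hs : s ∈ Icc 0 (2 * ω) \ S) : betaDenom u ψ lam s ≠ 0 :=
    fun hzero ↦ hs.2 ⟨hs.1, hzero⟩
  have hfinite : S.Finite := (h.finite_zeros_exp_mul_deriv hL 0 (2 * ω)).subset
    fun s hs ↦ ⟨hs.1, ((betaDenom_eq_zero_iff hlam).mp hs.2).2⟩
  have hreflect (s : ℝ) (hs : s ∈ S) : 0 + 2 * ω - s ∈ S :=
    ⟨⟨by linarith [hs.1.2], by linarith [hs.1.1]⟩, by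
      rw [zero_add, h.betaDenom_two_mul_ω_sub hL hlam him, hs.2, neg_zero]⟩
  have hpv := HasPrincipalValue.of_reflect_add (mul_pos two_pos hL.ω_pos).le hfinite hreflect
    (hf.mono fun s ↦ hne) fun s hs ↦ by rw [zero_add, hfc s (hne hs)]
  simpa using hpv

lemma hasPrincipalValue_betaOneIntegrand :
    HasPrincipalValue (betaOneIntegrand u ψ lam) 0 (2 * ω)
      {s | s ∈ Icc 0 (2 * ω) ∧ betaDenom u ψ lam s = 0} (2 * ω * I) := by
  refine h.hasPrincipalValue_of_reflect_add hL hlam him h.continuousOn_betaOneIntegrand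
    fun s hs ↦ ?_
  have hreflect := h.betaDenom_two_mul_ω_sub hL hlam him s
  rw [betaOneIntegrand_eq hlam hs, betaOneIntegrand_eq hlam (by rwa [hreflect, neg_ne_zero]),
    hreflect, div_neg]
  ring

lemma hasPrincipalValue_betaTwoIntegrand :
    HasPrincipalValue (betaTwoIntegrand u ψ lam) 0 (2 * ω)
      {s | s ∈ Icc 0 (2 * ω) ∧ betaDenom u ψ lam s = 0} 0 := by
  have hpv := h.hasPrincipalValue_of_reflect_add (c := 0) hL hlam him
    h.continuousOn_betaTwoIntegrand fun s _ ↦ by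
      rw [betaTwoIntegrand, betaTwoIntegrand, h.betaDenom_two_mul_ω_sub hL hlam him,
        h.exp_two_mul_ω_sub hL, div_neg, add_neg_cancel, mul_zero]
  rwa [mul_zero] at hpv

end PrincipalValue

end IsEquivariantMetric

namespace IsShiftedRoots

variable {ψ lam : ℂ} {β ω τ : ℝ} {e : Fin 3 → ℝ} {L : PeriodPair}

lemma phaseIntegrand_eigenvalue (he : IsShiftedRoots ψ lam β e) (u : ℝ → ℝ) (hlam : ‖lam‖ = 1)
    (hre : (hopfCoeff ψ lam).re ≠ 0) (j : Fin 3) (s : ℝ) :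
    phaseIntegrand u ψ lam (eigenvalue ψ lam β e j) s =
      -2 * (hopfCoeff ψ lam).im * (IsEquivariantMetric.profile u β s - e j)⁻¹ := by
  have hd := he.eigenvalue_ne_zero hlam hre j
  have hmul := he.eigenvalue_mul hlam hre j
  rw [phaseIntegrand]
  generalize eigenvalue ψ lam β e j = d at *
  have hdenom : d * Real.exp (u s) - (hopfCoeff ψ lam).re =
      d / -2 * (IsEquivariantMetric.profile u β s - e j) := by
    rw [IsEquivariantMetric.profile]
    linear_combination -hmul / 2
  rw [hdenom, mul_div_mul_comm, div_div_cancel₀ hd, div_eq_mul_inv, mul_assoc]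

lemma derivWeierstrassP_sq (he : IsShiftedRoots ψ lam β e)
    (hL : IsMetricLattice L ψ β ω τ) {α : ℂ} {j : Fin 3} (hα : α ∉ L.lattice)
    (hx : L.weierstrassP α = e j) :
    L.derivWeierstrassP α ^ 2 = (-16 * (hopfCoeff ψ lam).im ^ 2 : ℝ) := by
  rw [L.derivWeierstrassP_sq α hα, hL.g₂_eq, hL.g₃_eq, hx]
  exact_mod_cast he.cubic_self j

lemma derivWeierstrassP_ne_zero (he : IsShiftedRoots ψ lam β e)
    (hL : IsMetricLattice L ψ β ω τ) (him : (hopfCoeff ψ lam).im ≠ 0) {α : ℂ} {j : Fin 3}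
    (hα : α ∉ L.lattice) (hx : L.weierstrassP α = e j) : L.derivWeierstrassP α ≠ 0 := by
  intro hzero
  have hsq := he.derivWeierstrassP_sq hL hα hx
  simp [hzero, him] at hsq

end IsShiftedRoots

namespace IsEquivariantMetric

variable {u : ℝ → ℝ} {ψ lam : ℂ} {β ω τ : ℝ} {e : Fin 3 → ℝ} {L : PeriodPair}
  (h : IsEquivariantMetric u ψ β) (he : IsShiftedRoots ψ lam β e)
include h he

lemma prod_profile_sub (s : ℝ) :
    ∏ j, (profile u β s - e j) =
      (Real.exp (u s) * deriv u s) ^ 2 + 4 * (hopfCoeff ψ lam).im ^ 2 := by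
  have hprod := he.prod_sub (profile u β s)
  rw [profile] at hprod ⊢
  linear_combination hprod / 4 - h.exp_mul_deriv_sq s

variable (him : (hopfCoeff ψ lam).im ≠ 0)
include him

lemma profile_ne (j : Fin 3) (s : ℝ) : profile u β s ≠ e j := by
  have hprod : ∏ j, (profile u β s - e j) ≠ 0 := by
    rw [h.prod_profile_sub he]
    positivity
  exact sub_ne_zero.mp (Finset.prod_ne_zero_iff.mp hprod j (Finset.mem_univ j))

lemma continuous_inv_profile_sub (j : Fin 3) :
    Continuous fun s ↦ (profile u β s - e j)⁻¹ :=
  (h.continuous_profile.sub continuous_const).inv₀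
    fun s ↦ sub_ne_zero.mpr (h.profile_ne he him j s)

lemma continuous_phaseIntegrand_eigenvalue (hlam : ‖lam‖ = 1)
    (hre : (hopfCoeff ψ lam).re ≠ 0) (j : Fin 3) :
    Continuous (phaseIntegrand u ψ lam (IsShiftedRoots.eigenvalue ψ lam β e j)) := by
  rw [funext (he.phaseIntegrand_eigenvalue u hlam hre j)]
  exact continuous_const.mul (h.continuous_inv_profile_sub he him j)

lemma integral_linear_div_prod (m n a b : ℝ) :
    ∫ s in a..b, (m + n * profile u β s) / ∏ j, (profile u β s - e j) =
      ∑ j, (m + n * e j) / rootProduct e j * ∫ s in a..b, (profile u β s - e j)⁻¹ := by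
  simp_rw [fun s ↦ linear_div_prod_sub_eq_sum he.strictAnti.injective (h.profile_ne he him · s) m n]
  rw [intervalIntegral.integral_finsetSum fun j _ ↦
    ((h.continuous_inv_profile_sub he him j).intervalIntegrable a b).const_mul _]
  simp_rw [intervalIntegral.integral_const_mul]

variable (hL : IsMetricLattice L ψ β ω τ)
include hL

lemma exists_weierstrassP_eq_root (j : Fin 3) :
    ∃ α : ℂ, α ∉ L.lattice ∧ |α.im| < τ ∧ L.weierstrassP α = e j := by
  obtain ⟨e₁, e₂, hroots⟩ := h.exists_hasRealRoots hL
  have hcubic := hroots.cubic (e j)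
  rw [hL.g₂_eq, hL.g₃_eq] at hcubic
  have hneg : 4 * (e j - e₁) * (e j - e₂) * (e j - profile u β 0) < 0 := by
    have hself := he.cubic_self j
    have hvalue : 4 * (e j - e₁) * (e j - e₂) * (e j - profile u β 0) =
        -16 * (hopfCoeff ψ lam).im ^ 2 := by
      rw [← hself]
      exact_mod_cast hcubic.symm
    have hsq : 0 < (hopfCoeff ψ lam).im ^ 2 := by positivity
    linarith
  obtain hlt | hmem := (four_mul_cubic_neg_iff hroots.lt₁₂ hroots.lt₂₃).mp hneg
  · exact hroots.exists_weierstrassP_eq_of_lt hL.toIsRectangular hlt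
  · exact hroots.exists_weierstrassP_eq_of_mem_Ioo hL.toIsRectangular hmem

lemma integral_div_betaDenom (hlam : ‖lam‖ = 1) (m n : ℝ) :
    ∫ s in (0 : ℝ)..(2 * ω), ((m + n * profile u β s : ℝ) : ℂ) / betaDenom u ψ lam s =
      2 * I * (hopfCoeff ψ lam).im * ∑ j, ((m + n * e j) / rootProduct e j : ℝ) *
        ((∫ s in (0 : ℝ)..(2 * ω), (profile u β s - e j)⁻¹ : ℝ) : ℂ) := by
  have hreflect (s : ℝ) : ((m + n * profile u β s : ℝ) : ℂ) / betaDenom u ψ lam s +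
      ((m + n * profile u β (0 + 2 * ω - s) : ℝ) : ℂ) / betaDenom u ψ lam (0 + 2 * ω - s) =
      2 * (2 * I * (hopfCoeff ψ lam).im *
        ((m + n * profile u β s) / ∏ j, (profile u β s - e j) : ℝ)) := by
    rw [zero_add, h.profile_two_mul_ω_sub hL, div_eq_mul_inv, div_eq_mul_inv, ← mul_add,
      inv_add_inv (betaDenom_ne_zero hlam him _) (betaDenom_ne_zero hlam him _),
      h.betaDenom_add_two_mul_ω_sub hL hlam, h.betaDenom_mul_two_mul_ω_sub hL hlam,
      h.prod_profile_sub he, ofReal_neg, div_neg, ofReal_div]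
    ring
  rw [intervalIntegral_eq_of_reflect_add (mul_pos two_pos hL.ω_pos).le
      ((h.continuous_linear_div_betaDenom hlam him m n).intervalIntegrable _ _) hreflect,
    intervalIntegral.integral_const_mul, intervalIntegral.integral_ofReal,
    h.integral_linear_div_prod he him]
  push_cast
  rfl

variable {α : Fin 3 → ℂ}
  (hα : ∀ j, α j ∉ L.lattice ∧ |(α j).im| < τ ∧ L.weierstrassP (α j) = e j)
include hα

lemma integral_inv_profile_sub_root (j : Fin 3) :
    ((∫ s in (0 : ℝ)..(2 * ω), (profile u β s - e j)⁻¹ : ℝ) : ℂ) = zetaTerm L ω (α j) := by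
  obtain ⟨hmem, him_lt, hx⟩ := hα j
  exact h.integral_inv_profile_sub hL him_lt (he.derivWeierstrassP_ne_zero hL him hmem hx) hx

variable (hlam : ‖lam‖ = 1)
include hlam

lemma integral_div_betaDenom_eq_zetaTerm (m n : ℝ) :
    ∫ s in (0 : ℝ)..(2 * ω), ((m + n * profile u β s : ℝ) : ℂ) / betaDenom u ψ lam s =
      2 * I * (hopfCoeff ψ lam).im *
        ∑ j, ((m + n * e j) / rootProduct e j : ℝ) * zetaTerm L ω (α j) := by
  simp_rw [h.integral_div_betaDenom he him hL hlam, h.integral_inv_profile_sub_root he him hL hα]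

lemma betaOne_two_mul_ω :
    betaOne u ψ lam (2 * ω) = 2 * ω * I - 4 * (hopfCoeff ψ lam).im * (hopfCoeff ψ lam).re *
      ∑ j, 1 / (rootProduct e j : ℂ) * zetaTerm L ω (α j) := by
  have hintegrand : betaOneIntegrand u ψ lam = fun s ↦ I + 2 * I * (hopfCoeff ψ lam).re *
      (((1 + 0 * profile u β s : ℝ) : ℂ) / betaDenom u ψ lam s) := by
    funext s
    rw [betaOneIntegrand_eq hlam (betaDenom_ne_zero hlam him s), zero_mul, add_zero, ofReal_one,
      mul_one_div]
  rw [betaOne, hintegrand, intervalIntegral.integral_add intervalIntegrable_const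
    (((h.continuous_linear_div_betaDenom hlam him 1 0).intervalIntegrable _ _).const_mul _),
    intervalIntegral.integral_const, intervalIntegral.integral_const_mul,
    h.integral_div_betaDenom_eq_zetaTerm he him hL hα hlam, real_smul]
  simp only [zero_mul, add_zero, sub_zero, ofReal_div, ofReal_one, ofReal_mul, ofReal_ofNat]
  linear_combination (4 * (hopfCoeff ψ lam).im * (hopfCoeff ψ lam).re *
    ∑ j, 1 / (rootProduct e j : ℂ) * zetaTerm L ω (α j)) * I_sq

lemma betaTwo_two_mul_ω :
    betaTwo u ψ lam (2 * ω) = 2 * I * (hopfCoeff ψ lam).im *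
      ∑ j, ((β / 3 - e j) / rootProduct e j : ℝ) * zetaTerm L ω (α j) := by
  have hintegrand : betaTwoIntegrand u ψ lam = fun s ↦
      ((β / 3 + -1 * profile u β s : ℝ) : ℂ) / betaDenom u ψ lam s := by
    funext s
    rw [betaTwoIntegrand, profile]
    congr 2
    ring
  rw [betaTwo, hintegrand, h.integral_div_betaDenom_eq_zetaTerm he him hL hα hlam]
  simp only [neg_one_mul, ← sub_eq_add_neg]

lemma phaseG_eigenvalue_two_mul_ω (hre : (hopfCoeff ψ lam).re ≠ 0) (j : Fin 3) :
    (phaseG u ψ lam (IsShiftedRoots.eigenvalue ψ lam β e j) (2 * ω) : ℂ) =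
      -2 * (hopfCoeff ψ lam).im * zetaTerm L ω (α j) := by
  rw [phaseG]
  simp only [he.phaseIntegrand_eigenvalue u hlam hre, intervalIntegral.integral_const_mul]
  rw [ofReal_mul, h.integral_inv_profile_sub_root he him hL hα]
  push_cast
  rfl

end IsEquivariantMetric

theorem mainTheorem2
    (u : ℝ → ℝ) (ψ : ℂ) (β : ℝ) (hu : IsEquivariantMetric u ψ β)
    (lam : ℂ) (hlam : ‖lam‖ = 1)
    (ω τ : ℝ) (hω : 0 < ω) (hτ : 0 < τ)
    (L : PeriodPair) (hL₁ : L.ω₁ = 2 * ω) (hL₂ : L.ω₂ = 2 * (Complex.I * τ))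
    (g₂ g₃ : ℝ) (hg₂ : g₂ = 4 / 3 * β ^ 2) (hg₃ : g₃ = 16 * ‖ψ‖ ^ 2 - 8 / 27 * β ^ 3)
    (hLg₂ : L.g₂ = g₂) (hLg₃ : L.g₃ = g₃) :
    ((hopfCoeff ψ lam).im ≠ 0 → (hopfCoeff ψ lam).re ≠ 0 →
      ∃ e d : Fin 3 → ℝ,
        StrictAnti e ∧
        (∀ x : ℂ, 4 * x ^ 3 - g₂ * x - (g₃ - 16 * (hopfCoeff ψ lam).im ^ 2 : ℝ)
          = 4 * ∏ j, (x - e j)) ∧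
        (potentialMatrix u ψ lam).charpoly
          = ∏ j, (Polynomial.X - Polynomial.C (Complex.I * (d j : ℂ))) ∧
        (∀ j, e j = β / 3 + d (j + 1) * d (j + 2)) ∧
        (∀ j, ∃ α : ℂ, α ∉ L.lattice ∧ |α.im| < τ ∧ L.weierstrassP α = e j) ∧
        IntervalIntegrable (betaOneIntegrand u ψ lam) MeasureTheory.volume 0 (2 * ω) ∧
        IntervalIntegrable (betaTwoIntegrand u ψ lam) MeasureTheory.volume 0 (2 * ω) ∧
        (∀ j, IntervalIntegrable (phaseIntegrand u ψ lam (d j)) MeasureTheory.volume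
          0 (2 * ω)) ∧
        ∀ α : Fin 3 → ℂ,
          (∀ j, α j ∉ L.lattice ∧ |(α j).im| < τ ∧ L.weierstrassP (α j) = e j) →
          (∀ j, L.derivWeierstrassP (α j) ≠ 0) ∧
          betaOne u ψ lam (2 * ω) = 2 * ω * Complex.I
            - 4 * (hopfCoeff ψ lam).im * (hopfCoeff ψ lam).re
              * ∑ j, 1 / (rootProduct e j : ℂ) * zetaTerm L ω (α j) ∧
          betaTwo u ψ lam (2 * ω) = 2 * Complex.I * (hopfCoeff ψ lam).im
              * ∑ j, ((β / 3 - e j) / rootProduct e j : ℝ) * zetaTerm L ω (α j) ∧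
          ∀ j, (phaseG u ψ lam (d j) (2 * ω) : ℂ)
            = -2 * (hopfCoeff ψ lam).im * zetaTerm L ω (α j)) ∧
    ((hopfCoeff ψ lam).im = 0 →
      HasPrincipalValue (betaOneIntegrand u ψ lam) 0 (2 * ω)
        {s | s ∈ Set.Icc 0 (2 * ω) ∧ betaDenom u ψ lam s = 0} (2 * ω * Complex.I) ∧
      HasPrincipalValue (betaTwoIntegrand u ψ lam) 0 (2 * ω)
        {s | s ∈ Set.Icc 0 (2 * ω) ∧ betaDenom u ψ lam s = 0} 0 ∧
      ∀ d : ℝ, (potentialMatrix u ψ lam).charpoly.IsRoot (Complex.I * d) →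
        phaseG u ψ lam d (2 * ω) = 0) := by
  subst hg₂ hg₃
  have hL : IsMetricLattice L ψ β ω τ := ⟨⟨hω, hτ, hL₁, hL₂⟩, hLg₂, hLg₃⟩
  refine ⟨fun him hre ↦ ?_, fun him ↦ ⟨hu.hasPrincipalValue_betaOneIntegrand hL hlam him,
    hu.hasPrincipalValue_betaTwoIntegrand hL hlam him, fun d _ ↦ by
      simp [phaseG, phaseIntegrand, him]⟩⟩
  obtain ⟨e, he⟩ := hu.exists_isShiftedRoots hlam hre
  refine ⟨e, IsShiftedRoots.eigenvalue ψ lam β e, he.strictAnti, he.cubic,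
    hu.charpoly_potentialMatrix_eq_prod he hlam hre, he.eq_eigenvalue_mul hlam hre,
    hu.exists_weierstrassP_eq_root he him hL,
    (hu.continuous_betaOneIntegrand hlam him).intervalIntegrable _ _,
    (hu.continuous_betaTwoIntegrand hlam him).intervalIntegrable _ _,
    fun j ↦ (hu.continuous_phaseIntegrand_eigenvalue he him hlam hre j).intervalIntegrable _ _,
    fun α hα ↦ ⟨fun j ↦ he.derivWeierstrassP_ne_zero hL him (hα j).1 (hα j).2.2,
      hu.betaOne_two_mul_ω he him hL hα hlam, hu.betaTwo_two_mul_ω he him hL hα hlam,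
      hu.phaseG_eigenvalue_two_mul_ω he him hL hα hlam hre⟩⟩
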